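/- Let $A_{-1},A_0,A_1$ be real $m\times m$ matrices and $\varphi(z)=-z^{-1}A_{-1}+(I-A_0)-zA_1$. Call them QBD blocks if they are entrywise nonnegative and $A_{-1}+A_0+A_1$ is stochastic and irreducible. An off-diagonal block of an $m\times m$ matrix is a submatrix contained in the strictly lower or in the strictly upper triangular part; a matrix is $k$-quasiseparable if all its off-diagonal blocks have rank at most $k$. Let $|\lambda_1|\le|\lambda_2|\le\cdots$ be the moduli of the finite eigenvalues of $\varphi$, i.e. of the roots of the polynomial $\det(z\varphi(z))$ counted with multiplicity. If $|\lambda_m|$ and $|\lambda_{m+1}|$ exist and are positive, put $\theta=\sqrt{|\lambda_m||\lambda_{m+1}|}$ and $\varphi_\theta(z)=\varphi(\theta z)$, the function belonging to the blocks $\theta^{-1}A_{-1},\,A_0,\,\theta A_1$. Cyclic reduction applied to blocks $A_i^{(0)}$ computes, with $S^{(h)}=(A_0^{(h)}-I)^{-1}$, $$A_{\pm1}^{(h+1)}=-A_{\pm1}^{(h)}S^{(h)}A_{\pm1}^{(h)},\qquad A_0^{(h+1)}=A_0^{(h)}-A_1^{(h)}S^{(h)}A_{-1}^{(h)}-A_{-1}^{(h)}S^{(h)}A_1^{(h)}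 .$$ Let $\varphi_\theta^{(h)}(z)=-z^{-1}A_{-1}^{(h)}+(I-A_0^{(h)})-zA_1^{(h)}$, where the $A_i^{(h)}$ are obtained by $h$ steps from $A_{-1}^{(0)}=\theta^{-1}A_{-1}$, $A_0^{(0)}=A_0$, $A_1^{(0)}=\theta A_1$. **Theorem.** For all $t>1$ and $\delta\ge0$ there is a constant $\gamma(\delta,t)$, depending only on $\delta$ and $t$, such that the following holds for all $k\ge1$, all $m$ and all $k$-quasiseparable QBD blocks $A_{-1},A_0,A_1$ of size $m$ with $|\lambda_m|>0$ and $t<|\lambda_{m+1}|/|\lambda_m|$, for which $\varphi_\theta(z)$ is invertible with $\|\varphi_\theta(z)^{-1}\|_2\le\delta$ whenever $t^{-1}\le|z|\le t$. For every $h\ge0$ the matrix $A_0^{(h)}-I$ is invertible (so that cyclic reduction is well defined), and for every $z$ with $|z|=1$ and every off-diagonal block $C^{(h)}(z)$ of $\varphi_\theta^{(h)}(z)$, $$\sigma_s\bigl(C^{(h)}(z)\bigr)\le\gamma(\delta,t)\,e^{-\frac{s-3k}{6k}\log t}\qquad(s\ge1),$$ where $\sigma_1\ge\sigma_2\ge\cdots$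 are the singular values, continued by zeros. -/

import Mathlib

open Matrix Polynomial
open scoped Matrix.Norms.L2Operator

noncomputable section

/-- A triple `(A₋₁, A₀, A₁)` of real `m × m` matrices. -/
structure BlockTriple (m : ℕ) where
  Am : Matrix (Fin m) (Fin m) ℝ
  A0 : Matrix (Fin m) (Fin m) ℝ
  Ap : Matrix (Fin m) (Fin m) ℝ

namespace BlockTriple

variable {m : ℕ}

/-- The matrix Laurent polynomial `φ(z) = -z⁻¹ A₋₁ + (I - A₀) - z A₁`, for `z ≠ 0`. -/
def phi (A : BlockTriple m) (z : ℂ) : Matrix (Fin m) (Fin m) ℂ :=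
  -(z⁻¹ • A.Am.map Complex.ofReal) + (1 - A.A0.map Complex.ofReal)
    - z • A.Ap.map Complex.ofReal

/-- The triple `(θ⁻¹ A₋₁, A₀, θ A₁)`, whose matrix function is `z ↦ φ(θ z)`. -/
def rescale (A : BlockTriple m) (θ : ℝ) : BlockTriple m where
  Am := θ⁻¹ • A.Am
  A0 := A.A0
  Ap := θ • A.Ap

theorem phi_rescale (A : BlockTriple m) (θ : ℝ) (z : ℂ) :
    (A.rescale θ).phi z = A.phi (θ * z) := by
  ext i j
  simp [phi, rescale]
  ring

/-- One step of cyclic reduction, with `S = (A₀ - I)⁻¹` (meaningful when `A₀ - I` is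
invertible). -/
def crStep (A : BlockTriple m) : BlockTriple m where
  Am := -(A.Am * (A.A0 - 1)⁻¹ * A.Am)
  A0 := A.A0 - A.Ap * (A.A0 - 1)⁻¹ * A.Am - A.Am * (A.A0 - 1)⁻¹ * A.Ap
  Ap := -(A.Ap * (A.A0 - 1)⁻¹ * A.Ap)

/-- The triple `(A₋₁⁽ʰ⁾, A₀⁽ʰ⁾, A₁⁽ʰ⁾)` obtained after `h` steps of cyclic reduction. -/
def cr (A : BlockTriple m) (h : ℕ) : BlockTriple m :=
  crStep^[h] A

/-- The transition blocks of a QBD process: nonnegative matrices whose sum is stochastic and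
irreducible. -/
structure IsQBD (A : BlockTriple m) : Prop where
  nonneg_m : ∀ i j, 0 ≤ A.Am i j
  nonneg_0 : ∀ i j, 0 ≤ A.A0 i j
  nonneg_p : ∀ i j, 0 ≤ A.Ap i j
  stochastic : A.Am + A.A0 + A.Ap ∈ rowStochastic ℝ (Fin m)
  irreducible : (A.Am + A.A0 + A.Ap).IsIrreducible

/-- The polynomial `det (z φ(z)) = det (-A₋₁ + z (I - A₀) - z² A₁)`; its roots, counted with
multiplicity, are the finite eigenvalues of `φ`. -/
def charPoly (A : BlockTriple m) : ℂ[X] :=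
  Matrix.det (-(A.Am.map fun a => C (a : ℂ)) + (X : ℂ[X]) • (1 - A.A0.map fun a => C (a : ℂ))
    - (X ^ 2 : ℂ[X]) • A.Ap.map fun a => C (a : ℂ))

/-- `A.eigMod j = |λ_j|`, for `j = 1, 2, …`, where `|λ₁| ≤ |λ₂| ≤ …` are the moduli of the finite
eigenvalues of `φ`, with multiplicity; the value is `0` if there are fewer than `j` of them. -/
def eigMod (A : BlockTriple m) (j : ℕ) : ℝ :=
  ((A.charPoly.roots.map fun z => ‖z‖).sort (· ≤ ·)).getD (j - 1) 0

/-- The centring factor `θ = √(λ_m λ_{m+1})`. -/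
def theta (A : BlockTriple m) : ℝ :=
  √(A.eigMod m * A.eigMod (m + 1))

end BlockTriple

/-- The row set `I` and the column set `J` cut out a submatrix that lies strictly below, or
strictly above, the main diagonal. -/
def IsOffDiagonal {m : ℕ} (I J : Finset (Fin m)) : Prop :=
  (∀ i ∈ I, ∀ j ∈ J, j < i) ∨ (∀ i ∈ I, ∀ j ∈ J, i < j)

/-- The submatrix of `M` with row set `I` and column set `J`. -/
def block {m : ℕ} {R : Type*} (M : Matrix (Fin m) (Fin m) R) (I J : Finset (Fin m)) :
    Matrix I J R :=
  M.submatrix (fun i => i.1) (fun j => j.1)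

/-- `M` is `k`-quasiseparable: its off-diagonal submatrices have rank at most `k`. -/
def IsQuasiseparable {m : ℕ} (k : ℕ) (M : Matrix (Fin m) (Fin m) ℝ) : Prop :=
  ∀ I J : Finset (Fin m), IsOffDiagonal I J → (block M I J).rank ≤ k

/-- The `s`-th singular value `σ_s(M)`, `s = 1, 2, …`, in non-ascending order (and `0` when `s`
exceeds the number of columns). -/
def sigma {ι κ : Type*} [Fintype ι] [Fintype κ] [DecidableEq κ] (s : ℕ) (M : Matrix ι κ ℂ) : ℝ :=
  (Matrix.toEuclideanLin M).singularValues (s - 1)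

/-- The class `χ_{δ,t}`: the blocks `A` are those of a QBD process, they are `k`-quasiseparable,
`t < λ_{m+1} / λ_m`, and the rescaled function `z ↦ φ(θ z)` is invertible with
`‖φ(θ z)⁻¹‖₂ ≤ δ` on the closed annulus `t⁻¹ ≤ |z| ≤ t`. -/
structure MemChi (δ t : ℝ) (k : ℕ) {m : ℕ} (A : BlockTriple m) : Prop where
  isQBD : A.IsQBD
  quasisep_m : IsQuasiseparable k A.Am
  quasisep_0 : IsQuasiseparable k A.A0
  quasisep_p : IsQuasiseparable k A.Ap
  eigMod_pos : 0 < A.eigMod m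
  lt_ratio : t < A.eigMod (m + 1) / A.eigMod m
  isUnit_phi : ∀ z : ℂ, t⁻¹ ≤ ‖z‖ → ‖z‖ ≤ t → IsUnit (A.phi (A.theta * z))
  norm_inv_le : ∀ z : ℂ, t⁻¹ ≤ ‖z‖ → ‖z‖ ≤ t → ‖(A.phi (A.theta * z))⁻¹‖ ≤ δ

end

/-!
A nonnegative matrix `B` is called subcritical if `B v < v` for some positive vector `v`, i.e. if
`I - B` is a nonsingular M-matrix. A complex matrix `X` dominated entrywise by a subcritical `B`
satisfies `|(I - X)⁻¹| ≤ (I - B)⁻¹` entrywise, hence in the spectral norm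
(`IsDominatedBy.inv_one_sub`, `IsDominatedBy.norm_le`). All bounds independent of `m` come from
this comparison: `B ≤ (I - B)⁻¹` turns the hypothesis on `φ⁻¹` into a bound on `φ` itself.

*Subcriticality of the symbol.* The matrix `A(θ) = θ⁻¹ A₋₁ + A₀ + θ A₁` is subcritical
(`BlockTriple.isSubcritical_symbol_theta`). The proof counts roots: with `s < 1` in front of the
blocks, `s A(1)` is subcritical and `det (z I - s (A₋₁ + z A₀ + z² A₁))` has `m` roots in the unit
disc, as can be seen by letting `s` tend to `0`. For `s` close to `1` it also has `m` roots in the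
disc of radius `θ`, because this holds for `s = 1` by the choice of `θ`. So it has no root between
the two circles, and subcriticality propagates from `1` to `θ` along the real axis, where it can
only be lost at a singular matrix (`isSubcritical_of_path`).

*Cyclic reduction.* Each step keeps the blocks nonnegative and the symbol at `1` subcritical, and
`2 φ⁽ʰ⁺¹⁾(z²)⁻¹ = φ⁽ʰ⁾(z)⁻¹ + φ⁽ʰ⁾(-z)⁻¹`. Hence, on the unit circle, `φ⁽ʰ⁾(z)⁻¹` lies in the
convex hull of the values of `φ⁻¹` (`BlockTriple.IsNonneg.cr`).

*Low rank.* Let `P`, `Q` be complementary coordinate projections cutting out an off-diagonal block,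
and `A(z) = z⁻¹ A₋₁ + A₀ + z A₁`. Then `Q φ(z)⁻¹ P = Q φ(z)⁻¹ (Q A(z) P) G(z)`, where `G` is the
inverse of the diagonal block of `φ`. The Laurent coefficients of `G` are nonnegative, so that
evaluation at `t` and `t⁻¹` bounds the `j`-th one by `δ t ^ (-|j|)`. Truncation to `|j| ≤ n`
approximates the block by a sum of `3 (2 n + 1)` products, each with a fixed factor `Q A i P` of
rank at most `k` and a fixed coefficient of `G` on the right; only the left factors depend on `z`.
Therefore the approximation survives convex combinations at the same rank `3 k (2 n + 1)`
(`BlockTriple.exists_rank_le_norm_sub_le`). In the proof partial sums of the Neumann series stand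
in for `G`, so that only Laurent polynomials occur.

*Transfer to `φ⁽ʰ⁾`.* An off-diagonal block of a matrix is the product of the same block of the
inverse with two factors of bounded norm (`offDiagonal_eq_mul_offDiagonal_inv`), and the easy half
of the Eckart–Young theorem turns low-rank approximations into bounds on singular values
(`singularValues_le_of_finrank_range_le`).
-/

/-! ### Entrywise domination and subcritical matrices -/

section Domination

variable {ι : Type*} {𝕜 : Type*} [RCLike 𝕜]

/-- The entries of `X` are bounded in modulus by those of the real matrix `B`. -/
def IsDominatedBy (X : Matrix ι ι 𝕜) (B : Matrix ι ι ℝ) : Prop :=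
  ∀ i j, ‖X i j‖ ≤ B i j

theorem IsDominatedBy.nonneg {X : Matrix ι ι 𝕜} {B : Matrix ι ι ℝ} (h : IsDominatedBy X B)
    (i j : ι) : 0 ≤ B i j :=
  (norm_nonneg _).trans (h i j)

theorem isDominatedBy_self {B : Matrix ι ι ℝ} (h : ∀ i j, 0 ≤ B i j) : IsDominatedBy B B :=
  fun i j => by rw [Real.norm_of_nonneg (h i j)]

theorem IsDominatedBy.trans {X : Matrix ι ι 𝕜} {B B' : Matrix ι ι ℝ} (h : IsDominatedBy X B)
    (h' : ∀ i j, B i j ≤ B' i j) : IsDominatedBy X B' :=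
  fun i j => (h i j).trans (h' i j)

theorem IsDominatedBy.add {X Y : Matrix ι ι 𝕜} {B C : Matrix ι ι ℝ} (hX : IsDominatedBy X B)
    (hY : IsDominatedBy Y C) : IsDominatedBy (X + Y) (B + C) :=
  fun i j => (norm_add_le _ _).trans (add_le_add (hX i j) (hY i j))

theorem IsDominatedBy.smul {X : Matrix ι ι 𝕜} {B : Matrix ι ι ℝ} (hX : IsDominatedBy X B)
    {a : 𝕜} {b : ℝ} (hab : ‖a‖ ≤ b) : IsDominatedBy (a • X) (b • B) := fun i j => by
  simpa using mul_le_mul hab (hX i j) (norm_nonneg _) ((norm_nonneg _).trans hab)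

theorem isDominatedBy_map_ofReal {B : Matrix ι ι ℝ} (h : ∀ i j, 0 ≤ B i j) :
    IsDominatedBy (B.map Complex.ofReal) B := fun i j => by simp [abs_of_nonneg (h i j)]

theorem tendsto_entry {u : ℕ → Matrix ι ι 𝕜} {M : Matrix ι ι 𝕜}
    (h : Filter.Tendsto u Filter.atTop (nhds M)) (i j : ι) :
    Filter.Tendsto (fun l => u l i j) Filter.atTop (nhds (M i j)) :=
  tendsto_pi_nhds.1 (tendsto_pi_nhds.1 h i) j

theorem isDominatedBy_one [DecidableEq ι] : IsDominatedBy (1 : Matrix ι ι 𝕜) 1 := by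
  intro i j
  by_cases h : i = j <;> simp [Matrix.one_apply, h]

variable [Fintype ι]

theorem IsDominatedBy.mul {X Y : Matrix ι ι 𝕜} {B C : Matrix ι ι ℝ} (hX : IsDominatedBy X B)
    (hY : IsDominatedBy Y C) : IsDominatedBy (X * Y) (B * C) := by
  intro i j
  simp only [Matrix.mul_apply]
  refine (norm_sum_le _ _).trans (Finset.sum_le_sum fun l _ => ?_)
  rw [norm_mul]
  exact mul_le_mul (hX i l) (hY l j) (norm_nonneg _) (hX.nonneg i l)

/-- A nonnegative matrix `B` is subcritical when `B v < v` for some positive vector `v`; this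
says that `I - B` is a nonsingular M-matrix, i.e. that the spectral radius of `B` is less
than one. -/
def IsSubcritical (B : Matrix ι ι ℝ) : Prop :=
  ∃ v : ι → ℝ, (∀ i, 0 < v i) ∧ ∀ i, (B *ᵥ v) i < v i

theorem mulVec_entry_mono {B C : Matrix ι ι ℝ} (h : ∀ i j, B i j ≤ C i j) {v : ι → ℝ}
    (hv : ∀ i, 0 ≤ v i) (i : ι) : (B *ᵥ v) i ≤ (C *ᵥ v) i :=
  Finset.sum_le_sum fun j _ => mul_le_mul_of_nonneg_right (h i j) (hv j)

theorem mulVec_mono_right {B : Matrix ι ι ℝ} (h : ∀ i j, 0 ≤ B i j) {v w : ι → ℝ}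
    (hv : ∀ i, v i ≤ w i) (i : ι) : (B *ᵥ v) i ≤ (B *ᵥ w) i :=
  Finset.sum_le_sum fun j _ => mul_le_mul_of_nonneg_left (hv j) (h i j)

theorem IsSubcritical.mono {B C : Matrix ι ι ℝ} (hC : IsSubcritical C)
    (h : ∀ i j, B i j ≤ C i j) : IsSubcritical B := by
  obtain ⟨v, hv, hCv⟩ := hC
  exact ⟨v, hv, fun i => (mulVec_entry_mono h (fun j => (hv j).le) i).trans_lt (hCv i)⟩

theorem IsSubcritical.exists_contraction {B : Matrix ι ι ℝ} (hB : IsSubcritical B) :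
    ∃ v : ι → ℝ, (∀ i, 0 < v i) ∧ ∃ c : ℝ, 0 ≤ c ∧ c < 1 ∧ ∀ i, (B *ᵥ v) i ≤ c * v i := by
  obtain ⟨v, hv, hBv⟩ := hB
  refine ⟨v, hv, ?_⟩
  obtain ⟨c, hc⟩ : ∃ c : ℝ, (0 ≤ c ∧ c < 1) ∧ ∀ i, (B *ᵥ v) i ≤ c * v i := by
    have : ∀ᶠ c : ℝ in nhdsWithin 1 (Set.Iio 1), ∀ i, (B *ᵥ v) i < c * v i := by
      rw [Filter.eventually_all]
      intro i
      have hcont : Filter.Tendsto (fun c : ℝ => c * v i) (nhdsWithin 1 (Set.Iio 1))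
          (nhds (1 * v i)) :=
        ((continuous_id.mul continuous_const).tendsto 1).mono_left nhdsWithin_le_nhds
      exact hcont.eventually (lt_mem_nhds (by simpa using hBv i))
    have h2 : ∀ᶠ c : ℝ in nhdsWithin 1 (Set.Iio 1), 0 ≤ c ∧ c < 1 :=
      (((lt_mem_nhds zero_lt_one).mono fun _ h => le_of_lt h).filter_mono
        nhdsWithin_le_nhds).and self_mem_nhdsWithin
    obtain ⟨c, h3, h4⟩ := (this.and h2).exists
    exact ⟨c, h4, fun i => (h3 i).le⟩
  exact ⟨c, hc.1.1, hc.1.2, hc.2⟩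

variable [DecidableEq ι]

theorem IsDominatedBy.pow {X : Matrix ι ι 𝕜} {B : Matrix ι ι ℝ} (hX : IsDominatedBy X B)
    (l : ℕ) : IsDominatedBy (X ^ l) (B ^ l) := by
  induction l with
  | zero => simpa using isDominatedBy_one
  | succ l ih => simpa only [pow_succ] using ih.mul hX

theorem IsDominatedBy.geom_sum {X : Matrix ι ι 𝕜} {B : Matrix ι ι ℝ} (hX : IsDominatedBy X B)
    (L : ℕ) : IsDominatedBy (∑ l ∈ Finset.range L, X ^ l) (∑ l ∈ Finset.range L, B ^ l) := by
  induction L with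
  | zero => intro i j; simp
  | succ L ih => simpa only [Finset.sum_range_succ] using ih.add (hX.pow L)

theorem norm_le_of_mulVec_le {X : Matrix ι ι 𝕜} {c : ℝ} (hc : 0 ≤ c)
    (h : ∀ v : ι → 𝕜, ‖WithLp.toLp 2 (X *ᵥ v)‖ ≤ c * ‖WithLp.toLp 2 v‖) : ‖X‖ ≤ c := by
  rw [← Matrix.l2_opNorm_toEuclideanCLM]
  refine ContinuousLinearMap.opNorm_le_bound _ hc fun v => ?_
  exact h v.ofLp

theorem norm_toLp_mulVec_le (X : Matrix ι ι 𝕜) (v : ι → 𝕜) :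
    ‖WithLp.toLp 2 (X *ᵥ v)‖ ≤ ‖X‖ * ‖WithLp.toLp 2 v‖ :=
  Matrix.l2_opNorm_mulVec X (WithLp.toLp 2 v)

/-- Domination is inherited by the spectral norm, because `|X v| ≤ B |v|` for every vector. -/
theorem IsDominatedBy.norm_le {X : Matrix ι ι 𝕜} {B : Matrix ι ι ℝ} (h : IsDominatedBy X B) :
    ‖X‖ ≤ ‖B‖ := by
  refine norm_le_of_mulVec_le (norm_nonneg _) fun v => ?_
  have h1 := norm_toLp_mulVec_le B (fun i => ‖v i‖)
  have h2 : ‖WithLp.toLp 2 (fun i => ‖v i‖)‖ = ‖WithLp.toLp 2 v‖ := by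
    simp [EuclideanSpace.norm_eq]
  rw [h2] at h1
  refine le_trans ?_ h1
  rw [EuclideanSpace.norm_eq, EuclideanSpace.norm_eq]
  refine Real.sqrt_le_sqrt (Finset.sum_le_sum fun i _ => ?_)
  refine pow_le_pow_left₀ (norm_nonneg _) ?_ 2
  refine le_trans ?_ (le_abs_self _)
  simp only [Matrix.mulVec, dotProduct]
  refine (norm_sum_le _ _).trans (Finset.sum_le_sum fun j _ => ?_)
  rw [norm_mul]
  exact mul_le_mul_of_nonneg_right (h i j) (norm_nonneg _)

theorem norm_le_norm_map_ofReal (B : Matrix ι ι ℝ) : ‖B‖ ≤ ‖B.map Complex.ofReal‖ := by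
  refine norm_le_of_mulVec_le (norm_nonneg _) fun v => ?_
  have h1 := norm_toLp_mulVec_le (B.map Complex.ofReal) (fun i => (v i : ℂ))
  have h2 : (B.map Complex.ofReal) *ᵥ (fun i => (v i : ℂ)) = fun i => ((B *ᵥ v) i : ℂ) := by
    ext i
    simp [Matrix.mulVec, dotProduct]
  rw [h2] at h1
  simpa [EuclideanSpace.norm_eq] using h1

theorem norm_le_of_entry_le {B C : Matrix ι ι ℝ} (h0 : ∀ i j, 0 ≤ B i j)
    (h : ∀ i j, B i j ≤ C i j) : ‖B‖ ≤ ‖C‖ :=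
  ((isDominatedBy_self h0).trans h).norm_le

theorem tendsto_pow_of_isSubcritical {X : Matrix ι ι 𝕜} {B : Matrix ι ι ℝ}
    (hX : IsDominatedBy X B) (hB : IsSubcritical B) :
    Filter.Tendsto (fun l => X ^ l) Filter.atTop (nhds 0) := by
  obtain ⟨v, hv, c, hc0, hc1, hBv⟩ := hB.exists_contraction
  have hB0 := hX.nonneg
  have hpow0 : ∀ l i j, 0 ≤ (B ^ l) i j := fun l => (hX.pow l).nonneg
  have hpow : ∀ l i, ((B ^ l) *ᵥ v) i ≤ c ^ l * v i := by
    intro l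
    induction l with
    | zero => simp
    | succ l ih =>
      intro i
      rw [pow_succ', ← Matrix.mulVec_mulVec]
      calc (B *ᵥ (B ^ l *ᵥ v)) i ≤ (B *ᵥ (c ^ l • v)) i := mulVec_mono_right hB0 ih i
        _ = c ^ l * (B *ᵥ v) i := by rw [Matrix.mulVec_smul]; simp
        _ ≤ c ^ l * (c * v i) := mul_le_mul_of_nonneg_left (hBv i) (pow_nonneg hc0 l)
        _ = c ^ (l + 1) * v i := by ring
  refine tendsto_pi_nhds.2 fun i => tendsto_pi_nhds.2 fun j => ?_
  have hb : ∀ l, ‖(X ^ l) i j‖ ≤ c ^ l * v i / v j := by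
    intro l
    refine ((hX.pow l) i j).trans ?_
    rw [le_div_iff₀ (hv j)]
    refine le_trans ?_ (hpow l i)
    exact Finset.single_le_sum (f := fun j => (B ^ l) i j * v j)
      (fun j _ => mul_nonneg (hpow0 l i j) (hv j).le) (Finset.mem_univ j)
  have ht : Filter.Tendsto (fun l => c ^ l * v i / v j) Filter.atTop (nhds 0) := by
    simpa using ((tendsto_pow_atTop_nhds_zero_of_lt_one hc0 hc1).mul_const (v i)).div_const (v j)
  exact squeeze_zero_norm hb ht

theorem isUnit_one_sub_of_isSubcritical {X : Matrix ι ι 𝕜} {B : Matrix ι ι ℝ}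
    (hX : IsDominatedBy X B) (hB : IsSubcritical B) : IsUnit (1 - X) := by
  rw [← Matrix.mulVec_injective_iff_isUnit]
  intro u w huw
  have hd : X *ᵥ (u - w) = u - w := by
    have : (1 - X) *ᵥ (u - w) = 0 := by rw [Matrix.mulVec_sub, sub_eq_zero]; exact huw
    rw [Matrix.sub_mulVec, Matrix.one_mulVec, sub_eq_zero] at this
    exact this.symm
  have hp : ∀ l : ℕ, X ^ l *ᵥ (u - w) = u - w := by
    intro l
    induction l with
    | zero => simp
    | succ l ih => rw [pow_succ, ← Matrix.mulVec_mulVec, hd, ih]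
  have ht : Filter.Tendsto (fun l : ℕ => X ^ l *ᵥ (u - w)) Filter.atTop
      (nhds ((0 : Matrix ι ι 𝕜) *ᵥ (u - w))) :=
    ((continuous_id.matrix_mulVec continuous_const).tendsto (0 : Matrix ι ι 𝕜)).comp
      (tendsto_pow_of_isSubcritical hX hB)
  simp only [hp, Matrix.zero_mulVec] at ht
  exact sub_eq_zero.1 (tendsto_nhds_unique tendsto_const_nhds ht)

theorem one_sub_mul_inv {X : Matrix ι ι 𝕜} (h : IsUnit (1 - X)) : (1 - X) * (1 - X)⁻¹ = 1 :=
  Matrix.mul_nonsing_inv _ ((Matrix.isUnit_iff_isUnit_det _).1 h)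

/-- The Neumann series of a matrix dominated by a subcritical one. -/
theorem tendsto_geom_sum_inv {X : Matrix ι ι 𝕜} {B : Matrix ι ι ℝ}
    (hX : IsDominatedBy X B) (hB : IsSubcritical B) :
    Filter.Tendsto (fun L => ∑ l ∈ Finset.range L, X ^ l) Filter.atTop (nhds (1 - X)⁻¹) := by
  have h1 := one_sub_mul_inv (isUnit_one_sub_of_isSubcritical hX hB)
  have h2 : ∀ L : ℕ, ∑ l ∈ Finset.range L, X ^ l = (1 - X ^ L) * (1 - X)⁻¹ := fun L => by
    rw [← geom_sum_mul_neg, mul_assoc, h1, mul_one]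
  simp only [h2]
  simpa using ((tendsto_pow_of_isSubcritical hX hB).const_sub 1).mul_const (1 - X)⁻¹

theorem geom_sum_le_inv {B : Matrix ι ι ℝ} (h0 : ∀ i j, 0 ≤ B i j) (hB : IsSubcritical B)
    (L : ℕ) (i j : ι) : (∑ l ∈ Finset.range L, B ^ l) i j ≤ (1 - B)⁻¹ i j := by
  have hp : ∀ l i j, 0 ≤ (B ^ l) i j := fun l => ((isDominatedBy_self h0).pow l).nonneg
  refine Monotone.ge_of_tendsto (f := fun L => (∑ l ∈ Finset.range L, B ^ l) i j) ?_
    (tendsto_entry (tendsto_geom_sum_inv (isDominatedBy_self h0) hB) i j) L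
  refine monotone_nat_of_le_succ fun L => ?_
  rw [Finset.sum_range_succ]
  exact le_add_of_nonneg_right (hp L i j)

theorem IsDominatedBy.inv_one_sub {X : Matrix ι ι 𝕜} {B : Matrix ι ι ℝ}
    (hX : IsDominatedBy X B) (hB : IsSubcritical B) :
    IsDominatedBy (1 - X)⁻¹ (1 - B)⁻¹ := by
  intro i j
  refine le_of_tendsto (tendsto_entry (tendsto_geom_sum_inv hX hB) i j).norm ?_
  filter_upwards with L
  exact (hX.geom_sum L i j).trans (geom_sum_le_inv hX.nonneg hB L i j)

theorem inv_one_sub_nonneg {B : Matrix ι ι ℝ} (h0 : ∀ i j, 0 ≤ B i j) (hB : IsSubcritical B)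
    (i j : ι) : 0 ≤ (1 - B)⁻¹ i j :=
  ((isDominatedBy_self h0).inv_one_sub hB).nonneg i j

theorem le_inv_one_sub {B : Matrix ι ι ℝ} (h0 : ∀ i j, 0 ≤ B i j) (hB : IsSubcritical B)
    (i j : ι) : B i j ≤ (1 - B)⁻¹ i j := by
  have h := geom_sum_le_inv h0 hB 2 i j
  have h1 : 0 ≤ (1 : Matrix ι ι ℝ) i j := (isDominatedBy_one (𝕜 := ℝ)).nonneg i j
  rw [Finset.sum_range_succ, Finset.sum_range_one, pow_zero, pow_one, Matrix.add_apply] at h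
  linarith

theorem isSubcritical_of_inv_nonneg {B : Matrix ι ι ℝ} (h0 : ∀ i j, 0 ≤ B i j)
    (hu : IsUnit (1 - B)) (hi : ∀ i j, 0 ≤ (1 - B)⁻¹ i j) : IsSubcritical B := by
  have h1 : (1 - B) *ᵥ ((1 - B)⁻¹ *ᵥ 1) = 1 := by
    rw [Matrix.mulVec_mulVec, one_sub_mul_inv hu, Matrix.one_mulVec]
  set v := (1 - B)⁻¹ *ᵥ (1 : ι → ℝ) with hv
  have hv0 : ∀ i, 0 ≤ v i := fun i => by
    rw [hv]
    exact Finset.sum_nonneg fun j _ => mul_nonneg (hi i j) zero_le_one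
  have h2 : ∀ i, v i - (B *ᵥ v) i = 1 := fun i => by
    have := congrFun h1 i
    rwa [Matrix.sub_mulVec, Matrix.one_mulVec] at this
  have h3 : ∀ i, 0 ≤ (B *ᵥ v) i := fun i =>
    Finset.sum_nonneg fun j _ => mul_nonneg (h0 i j) (hv0 j)
  exact ⟨v, fun i => by linarith [h2 i, h3 i], fun i => by linarith [h2 i]⟩

/-- Along a path of nonnegative matrices `B` with `I - B` nonsingular, subcriticality is an open
condition (a strict inequality for a fixed vector) and a closed one (nonnegativity of the
inverse), so it propagates along the path. -/
theorem isSubcritical_of_path {B : ℝ → Matrix ι ι ℝ} {S : Set ℝ} (hS : IsPreconnected S)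
    (hcont : ContinuousOn B S) (h0 : ∀ x ∈ S, ∀ i j, 0 ≤ B x i j)
    (hu : ∀ x ∈ S, IsUnit (1 - B x)) {a b : ℝ} (ha : a ∈ S) (hb : b ∈ S)
    (hBa : IsSubcritical (B a)) : IsSubcritical (B b) := by
  have hentry : ∀ i j, ContinuousOn (fun x => B x i j) S := fun i j =>
    (continuous_apply_apply i j).comp_continuousOn hcont
  have : PreconnectedSpace S := isPreconnected_iff_preconnectedSpace.1 hS
  let T : Set S := {x | IsSubcritical (B x)}
  have hopen : IsOpen T := by
    rw [isOpen_iff_mem_nhds]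
    rintro x ⟨v, hv, hBv⟩
    have hc : ∀ i, Continuous fun y : S => (B y *ᵥ v) i := fun i => by
      refine continuous_finsetSum _ fun j _ => Continuous.mul ?_ continuous_const
      exact (continuousOn_iff_continuous_domRestrict.1 (hentry i j))
    have : ∀ᶠ y : S in nhds x, ∀ i, (B y *ᵥ v) i < v i :=
      Filter.eventually_all.2 fun i => (hc i).tendsto x |>.eventually (gt_mem_nhds (hBv i))
    filter_upwards [this] with y hy using ⟨v, hv, hy⟩
  have hT : T = {x : S | ∀ i j, 0 ≤ (1 - B x)⁻¹ i j} := by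
    ext x
    exact ⟨fun h => inv_one_sub_nonneg (h0 x x.2) h,
      fun h => isSubcritical_of_inv_nonneg (h0 x x.2) (hu x x.2) h⟩
  have hclosed : IsClosed T := by
    rw [hT]
    simp only [Set.ofPred_forall]
    refine isClosed_iInter fun i => isClosed_iInter fun j => isClosed_le continuous_const ?_
    have hB : Continuous fun x : S => 1 - B x :=
      continuous_const.sub (continuousOn_iff_continuous_domRestrict.1 hcont)
    have hinv : Continuous fun x : S => (1 - B x)⁻¹ := by
      simp only [Matrix.inv_def, Ring.inverse_eq_inv']
      have hdet : Continuous fun x : S => ((1 - B x).det)⁻¹ := hB.matrix_det.inv₀ fun x =>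
        ((Matrix.isUnit_iff_isUnit_det _).1 (hu x x.2)).ne_zero
      exact hdet.smul hB.matrix_adjugate
    exact (continuous_apply_apply i j).comp hinv
  have huniv : T = Set.univ := IsClopen.eq_univ ⟨hclosed, hopen⟩ ⟨⟨a, ha⟩, hBa⟩
  exact (huniv ▸ Set.mem_univ (⟨b, hb⟩ : S) : (⟨b, hb⟩ : S) ∈ T)

theorem isUnit_map_ofReal_iff {M : Matrix ι ι ℝ} :
    IsUnit (M.map Complex.ofReal) ↔ IsUnit M := by
  have h : (M.map Complex.ofReal).det = (M.det : ℂ) :=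
    (RingHom.map_det Complex.ofRealHom M).symm
  rw [Matrix.isUnit_iff_isUnit_det, Matrix.isUnit_iff_isUnit_det, h, isUnit_iff_ne_zero,
    isUnit_iff_ne_zero, Complex.ofReal_ne_zero]

theorem map_ofReal_inv {M : Matrix ι ι ℝ} (h : IsUnit M) :
    (M.map Complex.ofReal)⁻¹ = M⁻¹.map Complex.ofReal := by
  refine Matrix.inv_eq_right_inv ?_
  have h1 := congrArg (Complex.ofRealHom.mapMatrix)
    (Matrix.mul_nonsing_inv _ ((Matrix.isUnit_iff_isUnit_det _).1 h))
  rwa [map_mul, map_one] at h1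

end Domination

/-! ### Singular values and low-rank approximation -/

section SingularValues

open Module

/-- The easy half of the Eckart–Young theorem: if `L` has rank at most `r`, its kernel meets the
span of the first `r + 1` right singular vectors of `T`, on which `T` expands by at least the
`r`-th singular value (counted from zero). -/
theorem singularValues_le_of_finrank_range_le {E F : Type*}
    [NormedAddCommGroup E] [InnerProductSpace ℂ E] [FiniteDimensional ℂ E]
    [NormedAddCommGroup F] [InnerProductSpace ℂ F] [FiniteDimensional ℂ F]
    (T L : E →ₗ[ℂ] F) {r : ℕ} (hL : finrank ℂ (LinearMap.range L) ≤ r) {ε : ℝ} (hε : 0 ≤ ε)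
    (h : ∀ x, ‖T x - L x‖ ≤ ε * ‖x‖) : T.singularValues r ≤ ε := by
  by_cases hr : finrank ℂ E ≤ r
  · rw [T.singularValues_of_finrank_le hr]
    exact hε
  push Not at hr
  have hsym := T.isSymmetric_adjoint_comp_self
  let b := hsym.eigenvectorBasis rfl
  let emb : Fin (r + 1) → Fin (finrank ℂ E) := Fin.castLE hr
  let u : Fin (r + 1) → E := fun i => b (emb i)
  have hu : Orthonormal ℂ u := b.orthonormal.comp emb (Fin.castLE_injective hr)
  -- a nonzero combination of the first `r + 1` singular vectors killed by `L`
  have hli : ¬ LinearIndependent ℂ fun i => (L.rangeRestrict (u i)) := fun hli => by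
    have := hli.fintype_card_le_finrank
    rw [Fintype.card_fin] at this
    omega
  rw [Fintype.not_linearIndependent_iff] at hli
  obtain ⟨g, hg, i₀, hi₀⟩ := hli
  set x : E := ∑ i, g i • u i with hx
  have hLx : L x = 0 := by
    have := congrArg Subtype.val hg
    simpa [hx] using this
  have hnorm : ‖x‖ ^ 2 = ∑ i, ‖g i‖ ^ 2 := by
    rw [← inner_self_eq_norm_sq (𝕜 := ℂ), hx, hu.inner_sum]
    simp [← Complex.normSq_eq_conj_mul_self, Complex.normSq_eq_norm_sq]
    norm_cast
  have hTx : ‖T x‖ ^ 2 = ∑ i, ‖g i‖ ^ 2 * T.singularValues (i : ℕ) ^ 2 := by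
    have h1 : (LinearMap.adjoint T ∘ₗ T) x
        = ∑ i, (g i * (T.singularValues (i : ℕ) ^ 2 : ℝ)) • u i := by
      rw [hx, map_sum]
      refine Finset.sum_congr rfl fun i _ => ?_
      rw [map_smul, hsym.apply_eigenvectorBasis rfl (emb i), smul_smul,
        ← T.sq_singularValues_fin rfl (emb i)]
      rfl
    rw [← inner_self_eq_norm_sq (𝕜 := ℂ), ← LinearMap.adjoint_inner_right,
      ← LinearMap.comp_apply, h1, hx, hu.inner_sum, map_sum]
    refine Finset.sum_congr rfl fun i _ => ?_
    rw [← mul_assoc, ← Complex.normSq_eq_conj_mul_self, Complex.normSq_eq_norm_sq]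
    norm_cast
  have hge : T.singularValues r ^ 2 * ‖x‖ ^ 2 ≤ ‖T x‖ ^ 2 := by
    rw [hnorm, hTx, Finset.mul_sum]
    refine Finset.sum_le_sum fun i _ => ?_
    rw [mul_comm]
    refine mul_le_mul_of_nonneg_left ?_ (by positivity)
    exact pow_le_pow_left₀ (T.singularValues_nonneg r)
      (T.singularValues_antitone (Nat.lt_succ_iff.1 i.2)) 2
  have hx0 : 0 < ‖x‖ := by
    have : 0 < ‖x‖ ^ 2 := by
      rw [hnorm]
      exact Finset.sum_pos' (fun i _ => by positivity)
        ⟨i₀, Finset.mem_univ _, by have := norm_pos_iff.2 hi₀; positivity⟩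
    exact lt_of_le_of_ne (norm_nonneg x) fun h0 => by simp [← h0] at this
  have hle : ‖T x‖ ≤ ε * ‖x‖ := by simpa [hLx] using h x
  have h2 : T.singularValues r * ‖x‖ ≤ ‖T x‖ := by
    refine le_of_sq_le_sq ?_ (norm_nonneg _)
    rwa [mul_pow]
  exact le_of_mul_le_mul_right (h2.trans hle) hx0

theorem sigma_le_of_rank_le {ι κ : Type*} [Fintype ι] [Fintype κ] [DecidableEq κ]
    (X L : Matrix ι κ ℂ) {s : ℕ} (hL : L.rank ≤ s - 1) : sigma s X ≤ ‖X - L‖ := by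
  refine singularValues_le_of_finrank_range_le _ (Matrix.toEuclideanLin L) ?_ (norm_nonneg _) ?_
  · have e : Matrix.toEuclideanLin L =
        Matrix.toLin (PiLp.basisFun 2 ℂ κ) (PiLp.basisFun 2 ℂ ι) L :=
      DFunLike.congr_fun (Matrix.toLpLin_eq_toLin 2 2) L
    rw [e]
    rwa [Matrix.rank_eq_finrank_range_toLin L (PiLp.basisFun 2 ℂ ι) (PiLp.basisFun 2 ℂ κ)] at hL
  · intro x
    rw [← LinearMap.sub_apply, ← map_sub]
    exact Matrix.l2_opNorm_mulVec (X - L) x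

theorem norm_block_le {m : ℕ} (X : Matrix (Fin m) (Fin m) ℂ) (I J : Finset (Fin m)) :
    ‖block X I J‖ ≤ ‖X‖ := by
  rw [Matrix.l2_opNorm_def]
  refine ContinuousLinearMap.opNorm_le_bound _ (norm_nonneg _) fun v => ?_
  let w : Fin m → ℂ := fun j => if h : j ∈ J then v ⟨j, h⟩ else 0
  have hw : ∀ j : J, w j = v j := fun j => by simp [w]
  have hw0 : ∀ j ∉ J, w j = 0 := fun j hj => by simp [w, hj]
  have hnorm : ‖WithLp.toLp 2 w‖ = ‖v‖ := by
    rw [EuclideanSpace.norm_eq, EuclideanSpace.norm_eq]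
    congr 1
    rw [← Finset.sum_subset J.subset_univ (fun j _ hj => by simp [hw0 j hj]),
      ← Finset.sum_coe_sort J]
    simp [hw]
  rw [← hnorm]
  refine le_trans ?_ (norm_toLp_mulVec_le X w)
  rw [EuclideanSpace.norm_eq, EuclideanSpace.norm_eq]
  refine Real.sqrt_le_sqrt ?_
  calc _ = ∑ i : I, ‖(X *ᵥ w) i‖ ^ 2 := by
        refine Finset.sum_congr rfl fun i _ => ?_
        congr 2
        change (block X I J *ᵥ v.ofLp) i = _
        simp only [Matrix.mulVec, dotProduct]
        rw [← Finset.sum_subset J.subset_univ (fun j _ hj => by simp [hw0 j hj]),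
          ← Finset.sum_coe_sort J]
        simp [hw, block]
    _ = ∑ i ∈ I, ‖(X *ᵥ w) i‖ ^ 2 := Finset.sum_coe_sort I fun i => ‖(X *ᵥ w) i‖ ^ 2
    _ ≤ _ := Finset.sum_le_sum_of_subset_of_nonneg I.subset_univ fun _ _ _ => by positivity

theorem rank_add_le {m n : Type*} [Fintype m] [Fintype n] (A B : Matrix m n ℂ) :
    (A + B).rank ≤ A.rank + B.rank := by
  rw [Matrix.rank, Matrix.mulVecLin_add]
  refine (Submodule.finrank_mono (?_ : _ ≤ LinearMap.range A.mulVecLin ⊔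
    LinearMap.range B.mulVecLin)).trans (Submodule.finrank_add_le_finrank_add_finrank _ _)
  rintro _ ⟨v, rfl⟩
  exact Submodule.add_mem_sup (LinearMap.mem_range_self _ v) (LinearMap.mem_range_self _ v)

theorem rank_sum_le {ι : Type*} {m n : Type*} [Fintype m] [Fintype n] (S : Finset ι)
    (f : ι → Matrix m n ℂ) {r : ℕ} (h : ∀ i ∈ S, (f i).rank ≤ r) :
    (∑ i ∈ S, f i).rank ≤ S.card * r := by
  classical
  induction S using Finset.induction_on with
  | empty => simp
  | insert a S ha ih =>
    rw [Finset.sum_insert ha, Finset.card_insert_of_notMem ha, add_mul, one_mul, add_comm (_ * r)]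
    exact (rank_add_le _ _).trans (add_le_add (h a (Finset.mem_insert_self a S))
      (ih fun i hi => h i (Finset.mem_insert_of_mem hi)))

/-- The coordinate projection onto the index set `K`. -/
def coordProj {m : ℕ} (K : Finset (Fin m)) : Matrix (Fin m) (Fin m) ℂ :=
  Matrix.diagonal fun i => if i ∈ K then 1 else 0

theorem coordProj_mul_self {m : ℕ} (K : Finset (Fin m)) :
    coordProj K * coordProj K = coordProj K := by
  simp [coordProj]

theorem coordProj_compl {m : ℕ} (K : Finset (Fin m)) : coordProj Kᶜ = 1 - coordProj K := by
  rw [coordProj, coordProj, ← Matrix.diagonal_one, Matrix.diagonal_sub]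
  congr 1
  ext i
  by_cases h : i ∈ K <;> simp [h]

theorem norm_coordProj_le {m : ℕ} (K : Finset (Fin m)) : ‖coordProj K‖ ≤ 1 := by
  rw [coordProj, Matrix.l2_opNorm_diagonal]
  refine (pi_norm_le_iff_of_nonneg zero_le_one).2 fun i => ?_
  split_ifs <;> simp

theorem coordProj_mul_mul_apply {m : ℕ} (K K' : Finset (Fin m)) (X : Matrix (Fin m) (Fin m) ℂ)
    (i j : Fin m) :
    (coordProj K * X * coordProj K') i j = if i ∈ K ∧ j ∈ K' then X i j else 0 := by
  by_cases hi : i ∈ K <;> by_cases hj : j ∈ K' <;>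
    simp [coordProj, Matrix.mul_diagonal, Matrix.diagonal_mul, hi, hj]

theorem rank_coordProj_mul_mul_le {m : ℕ} (K K' : Finset (Fin m))
    (X : Matrix (Fin m) (Fin m) ℂ) :
    (coordProj K * X * coordProj K').rank ≤ (block X K K').rank := by
  have h : coordProj K * X * coordProj K' = (1 : Matrix (Fin m) (Fin m) ℂ).submatrix id
      (fun i : K => i.1) * block X K K' *
        (1 : Matrix (Fin m) (Fin m) ℂ).submatrix (fun i : K' => i.1) id := by
    ext i j
    rw [coordProj_mul_mul_apply]
    simp only [Matrix.mul_apply, block, Matrix.submatrix_apply, Matrix.one_apply, id]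
    simp only [ite_mul, one_mul, zero_mul, mul_ite, mul_one, mul_zero]
    rw [Finset.sum_coe_sort K' fun x => if x = j then
      ∑ y : K, if i = (y : Fin m) then X y x else 0 else 0, Finset.sum_ite_eq']
    rw [Finset.sum_coe_sort K fun y => if i = y then X y j else 0, Finset.sum_ite_eq]
    by_cases hi : i ∈ K <;> by_cases hj : j ∈ K' <;> simp [hi, hj]
  rw [h]
  exact (Matrix.rank_mul_le_left _ _).trans (Matrix.rank_mul_le_right _ _)

theorem rank_map_ofReal_le {ι κ : Type*} [Fintype ι] [Fintype κ] (M : Matrix ι κ ℝ) :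
    (M.map Complex.ofReal).rank ≤ M.rank := by
  -- a rank factorization through a basis of the column space survives complexification
  let S := Submodule.span ℝ (Set.range M.col)
  have hS : finrank ℝ S = M.rank := M.rank_eq_finrank_span_cols.symm
  let b := Module.finBasis ℝ S
  let U : Matrix ι (Fin (finrank ℝ S)) ℝ := Matrix.of fun i l => (b l : ι → ℝ) i
  let V : Matrix (Fin (finrank ℝ S)) κ ℝ :=
    Matrix.of fun l j => b.repr ⟨M.col j, Submodule.subset_span ⟨j, rfl⟩⟩ l
  have hM : M = U * V := by
    ext i j
    have h := congrArg (fun x : S => (x : ι → ℝ) i)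
      (b.sum_repr ⟨M.col j, Submodule.subset_span ⟨j, rfl⟩⟩)
    simp only [Submodule.coe_sum, Submodule.coe_smul, Finset.sum_apply, Pi.smul_apply,
      smul_eq_mul] at h
    rw [Matrix.mul_apply]
    refine h.symm.trans (Finset.sum_congr rfl fun l _ => ?_)
    simp [U, V, mul_comm]
  have hmap : M.map Complex.ofReal = U.map Complex.ofReal * V.map Complex.ofReal := by
    conv_lhs => rw [hM]
    exact Matrix.map_mul (f := Complex.ofRealHom)
  rw [hmap, ← hS]
  refine (Matrix.rank_mul_le_left _ _).trans ((Matrix.rank_le_card_width _).trans ?_)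
  simp

/-- A singular value estimate for a submatrix from a low-rank approximation of a padded
submatrix containing it. -/
theorem sigma_block_le {m : ℕ} {I J K K' : Finset (Fin m)} (hI : I ⊆ K) (hJ : J ⊆ K')
    (X L : Matrix (Fin m) (Fin m) ℂ) {s : ℕ} (hL : L.rank ≤ s - 1) :
    sigma s (block X I J) ≤ ‖coordProj K * X * coordProj K' - L‖ := by
  have h : block X I J = block (coordProj K * X * coordProj K') I J := by
    ext i j
    simp [block, coordProj_mul_mul_apply, hI i.2, hJ j.2]
  rw [h]
  refine (sigma_le_of_rank_le _ (block L I J) ?_).trans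
    (norm_block_le (coordProj K * X * coordProj K' - L) I J)
  exact (Matrix.rank_submatrix_le L _ _).trans hL

end SingularValues

/-! ### Counting the roots of a polynomial in a disc -/

section RootCount

/-- The number of roots of `p` in the open disc of radius `r` about the origin, with
multiplicity. -/
noncomputable def rootCount (p : ℂ[X]) (r : ℝ) : ℕ :=
  p.roots.countP fun z => ‖z‖ < r

theorem circleIntegrable_one_div_sub {r : ℝ} {w : ℂ} (hr : 0 < r) (hw : ‖w‖ ≠ r) :
    CircleIntegrable (fun z => 1 / (z - w)) 0 r := by
  refine ContinuousOn.circleIntegrable hr.le ?_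
  refine continuousOn_const.div (continuousOn_id.sub continuousOn_const) fun z hz h => hw ?_
  rw [← sub_eq_zero.1 h]
  simpa using hz

theorem circleIntegral_one_div_sub {r : ℝ} {w : ℂ} (hr : 0 < r) (hw : ‖w‖ ≠ r) :
    ∮ z in C(0, r), 1 / (z - w) = 2 * Real.pi * Complex.I * (if ‖w‖ < r then 1 else 0) := by
  by_cases h : ‖w‖ < r
  · simpa [h] using circleIntegral.integral_sub_inv_of_mem_ball (c := 0) (R := r) (w := w)
      (by simpa using h)
  · rw [if_neg h, mul_zero]
    have hlt : r < ‖w‖ := lt_of_le_of_ne (not_lt.1 h) hw.symm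
    have hne : ∀ z ∈ Metric.closedBall (0 : ℂ) r, z - w ≠ 0 := fun z hz h0 => by
      rw [sub_eq_zero.1 h0, mem_closedBall_zero_iff] at hz
      linarith
    refine Complex.circleIntegral_eq_zero_of_differentiable_on_off_countable hr.le
      Set.countable_empty ?_ fun z hz => ?_
    · exact continuousOn_const.div (continuousOn_id.sub continuousOn_const) hne
    · exact (differentiableAt_const _).div (differentiableAt_id.sub (differentiableAt_const _))
        (hne z (Metric.ball_subset_closedBall hz.1))

theorem circleIntegral_multiset_sum {r : ℝ} (hr : 0 < r) (s : Multiset ℂ)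
    (hs : ∀ w ∈ s, ‖w‖ ≠ r) :
    CircleIntegrable (fun z => (s.map fun w => 1 / (z - w)).sum) 0 r ∧
    ∮ z in C(0, r), (s.map fun w => 1 / (z - w)).sum =
      2 * Real.pi * Complex.I * (s.countP fun w => ‖w‖ < r : ℕ) := by
  induction s using Multiset.induction_on with
  | empty => simp [circleIntegrable_const, circleIntegral]
  | cons a s ih =>
    obtain ⟨h1, h2⟩ := ih fun w hw => hs w (Multiset.mem_cons_of_mem hw)
    have ha := hs a (Multiset.mem_cons_self a s)
    have h3 := circleIntegrable_one_div_sub hr ha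
    simp only [Multiset.map_cons, Multiset.sum_cons, Multiset.countP_cons]
    refine ⟨h3.add h1, ?_⟩
    rw [circleIntegral.integral_add h3 h1, h2, circleIntegral_one_div_sub hr ha]
    push_cast
    ring

/-- The argument principle for polynomials. -/
theorem circleIntegral_logDeriv {r : ℝ} (hr : 0 < r) {p : ℂ[X]}
    (hp : ∀ z ∈ Metric.sphere (0 : ℂ) r, p.eval z ≠ 0) :
    CircleIntegrable (fun z => p.derivative.eval z / p.eval z) 0 r ∧
    ∮ z in C(0, r), p.derivative.eval z / p.eval z =
      2 * Real.pi * Complex.I * (rootCount p r : ℕ) := by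
  have hs : ∀ w ∈ p.roots, ‖w‖ ≠ r := fun w hw h =>
    hp w (by simpa using h) (Polynomial.isRoot_of_mem_roots hw)
  obtain ⟨h1, h2⟩ := circleIntegral_multiset_sum hr p.roots hs
  refine ⟨?_, ?_⟩
  · refine ContinuousOn.circleIntegrable hr.le ?_
    exact p.derivative.continuous.continuousOn.div p.continuous.continuousOn hp
  · rw [rootCount, ← h2]
    refine circleIntegral.integral_congr hr.le fun z hz => ?_
    exact (IsAlgClosed.splits p).eval_derivative_div_eval_of_ne_zero (hp z hz)

/-- Rouché's theorem for polynomials: `log (p / q)` is a primitive of `p'/p - q'/q` along the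
circle. -/
theorem rootCount_eq_of_norm_sub_lt {r : ℝ} (hr : 0 < r) {p q : ℂ[X]}
    (h : ∀ z ∈ Metric.sphere (0 : ℂ) r, ‖p.eval z - q.eval z‖ < ‖q.eval z‖) :
    rootCount p r = rootCount q r := by
  have hq : ∀ z ∈ Metric.sphere (0 : ℂ) r, q.eval z ≠ 0 := fun z hz h0 => by
    have := h z hz
    rw [h0, norm_zero] at this
    exact absurd this (not_lt.2 (norm_nonneg _))
  have hp : ∀ z ∈ Metric.sphere (0 : ℂ) r, p.eval z ≠ 0 := fun z hz h0 => by
    have := h z hz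
    rw [h0, zero_sub, norm_neg] at this
    exact lt_irrefl _ this
  obtain ⟨hp1, hp2⟩ := circleIntegral_logDeriv hr hp
  obtain ⟨hq1, hq2⟩ := circleIntegral_logDeriv hr hq
  have h0 : ∮ z in C(0, r),
      (p.derivative.eval z / p.eval z - q.derivative.eval z / q.eval z) = 0 := by
    refine circleIntegral.integral_eq_zero_of_hasDerivWithinAt hr.le
      (f := fun z => Complex.log (p.eval z / q.eval z)) fun z hz => ?_
    have hmem : p.eval z / q.eval z ∈ Complex.slitPlane := by
      have h1 : ‖p.eval z / q.eval z - 1‖ < 1 := by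
        rw [div_sub_one (hq z hz), norm_div, div_lt_one (norm_pos_iff.2 (hq z hz))]
        exact h z hz
      simpa using Complex.mem_slitPlane_of_norm_lt_one h1
    have hd := ((p.hasDerivAt z).div (q.hasDerivAt z) (hq z hz)).clog hmem
    refine (hd.congr_deriv ?_).hasDerivWithinAt
    rw [Pi.div_apply]
    have := hp z hz
    have := hq z hz
    field_simp
  rw [circleIntegral.integral_sub hp1 hq1, hp2, hq2, ← mul_sub] at h0
  rcases mul_eq_zero.1 h0 with h3 | h3
  · exact absurd h3 Complex.two_pi_I_ne_zero
  · exact_mod_cast sub_eq_zero.1 h3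

/-- The number of roots in a disc does not change along a continuous family of polynomials
without roots on the bounding circle. -/
theorem rootCount_eq_of_path {r : ℝ} (hr : 0 < r) {p : ℝ → ℂ[X]}
    (hcont : Continuous fun x : ℝ × ℂ => (p x.1).eval x.2) {S : Set ℝ} (hS : IsPreconnected S)
    (hne : ∀ s ∈ S, ∀ z : ℂ, ‖z‖ = r → (p s).eval z ≠ 0) {a b : ℝ} (ha : a ∈ S) (hb : b ∈ S) :
    rootCount (p a) r = rootCount (p b) r := by
  refine hS.constant (f := fun s => rootCount (p s) r) (fun s hs => ?_) ha hb
  have h : ∀ᶠ x in nhds s, ∀ z ∈ Metric.sphere (0 : ℂ) r,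
      ‖(p x).eval z - (p s).eval z‖ < ‖(p s).eval z‖ := by
    refine (isCompact_sphere (0 : ℂ) r).eventually_forall_of_forall_eventually fun z hz => ?_
    have hc : Continuous fun x : ℝ × ℂ => (p s).eval x.2 :=
      (p s).continuous.comp continuous_snd
    refine (hcont.sub hc).norm.continuousAt.eventually_lt hc.norm.continuousAt ?_
    simpa using hne s hs z (by simpa using hz)
  refine ContinuousWithinAt.congr_of_eventuallyEq continuousWithinAt_const ?_ rfl
  exact nhdsWithin_le_nhds (h.mono fun x hx => rootCount_eq_of_norm_sub_lt hr hx)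

end RootCount

/-! ### The symbol of a QBD process inside the spectral gap -/

theorem countP_lt_of_sorted {l : List ℝ} (hl : l.Pairwise (· ≤ ·)) {n : ℕ} (hn : n < l.length)
    (hn0 : 0 < n) {θ : ℝ} (h1 : l.getD (n - 1) 0 < θ) (h2 : θ < l.getD n 0) :
    l.countP (fun x => x < θ) = n := by
  rw [List.getD_eq_getElem _ _ (by omega)] at h1
  rw [List.getD_eq_getElem _ _ hn] at h2
  rw [List.pairwise_iff_getElem] at hl
  rw [← List.take_append_drop n l, List.countP_append]
  have ht : (l.take n).countP (fun x => x < θ) = (l.take n).length := by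
    rw [List.countP_eq_length]
    intro a ha
    obtain ⟨i, hi, rfl⟩ := List.getElem_of_mem ha
    rw [List.length_take] at hi
    rw [List.getElem_take, decide_eq_true_eq]
    refine lt_of_le_of_lt ?_ h1
    rcases (show i ≤ n - 1 by omega).eq_or_lt with h | h
    · simp [h]
    · exact hl _ _ _ _ h
  have hd : (l.drop n).countP (fun x => x < θ) = 0 := by
    rw [List.countP_eq_zero]
    intro a ha
    obtain ⟨i, hi, rfl⟩ := List.getElem_of_mem ha
    rw [List.length_drop] at hi
    rw [List.getElem_drop, decide_eq_true_eq, not_lt]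
    refine h2.le.trans ?_
    rcases Nat.eq_zero_or_pos i with h | h
    · simp [h]
    · exact hl _ _ _ _ (by omega)
  rw [ht, hd, List.length_take]
  omega

namespace BlockTriple

variable {m : ℕ}

/-- The three blocks are entrywise nonnegative. -/
structure IsNonneg (A : BlockTriple m) : Prop where
  nonneg_m : ∀ i j, 0 ≤ A.Am i j
  nonneg_0 : ∀ i j, 0 ≤ A.A0 i j
  nonneg_p : ∀ i j, 0 ≤ A.Ap i j

theorem IsQBD.isNonneg {A : BlockTriple m} (h : A.IsQBD) : A.IsNonneg :=
  ⟨h.nonneg_m, h.nonneg_0, h.nonneg_p⟩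

/-- The matrix `x⁻¹ A₋₁ + A₀ + x A₁` for real `x`. -/
noncomputable def symbol (A : BlockTriple m) (x : ℝ) : Matrix (Fin m) (Fin m) ℝ :=
  x⁻¹ • A.Am + A.A0 + x • A.Ap

/-- The matrix `z⁻¹ A₋₁ + A₀ + z A₁` for complex `z`. -/
noncomputable def csymbol (A : BlockTriple m) (z : ℂ) : Matrix (Fin m) (Fin m) ℂ :=
  z⁻¹ • A.Am.map Complex.ofReal + A.A0.map Complex.ofReal + z • A.Ap.map Complex.ofReal

theorem phi_eq_one_sub (A : BlockTriple m) (z : ℂ) : A.phi z = 1 - A.csymbol z := by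
  rw [phi, csymbol]
  abel

theorem csymbol_ofReal (A : BlockTriple m) (x : ℝ) :
    A.csymbol x = (A.symbol x).map Complex.ofReal := by
  ext i j
  simp [csymbol, symbol]

theorem phi_ofReal (A : BlockTriple m) (x : ℝ) :
    A.phi x = (1 - A.symbol x).map Complex.ofReal := by
  rw [phi_eq_one_sub, csymbol_ofReal]
  ext i j
  by_cases h : i = j <;> simp [h]

theorem symbol_rescale (A : BlockTriple m) (θ x : ℝ) :
    (A.rescale θ).symbol x = A.symbol (θ * x) := by
  ext i j
  simp [symbol, rescale]
  ring

theorem IsNonneg.rescale {A : BlockTriple m} (h : A.IsNonneg) {θ : ℝ} (hθ : 0 ≤ θ) :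
    (A.rescale θ).IsNonneg where
  nonneg_m i j := mul_nonneg (inv_nonneg.2 hθ) (h.nonneg_m i j)
  nonneg_0 := h.nonneg_0
  nonneg_p i j := mul_nonneg hθ (h.nonneg_p i j)

theorem IsNonneg.isDominatedBy {A : BlockTriple m} (h : A.IsNonneg) (z : ℂ) :
    IsDominatedBy (A.csymbol z) (A.symbol ‖z‖) :=
  (((isDominatedBy_map_ofReal h.nonneg_m).smul (norm_inv z).le).add
    (isDominatedBy_map_ofReal h.nonneg_0)).add
    ((isDominatedBy_map_ofReal h.nonneg_p).smul le_rfl)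

theorem IsNonneg.symbol_nonneg {A : BlockTriple m} (h : A.IsNonneg) {x : ℝ} (hx : 0 ≤ x)
    (i j : Fin m) : 0 ≤ A.symbol x i j := by
  have := (h.isDominatedBy (x : ℂ)).nonneg i j
  rwa [Complex.norm_real, Real.norm_of_nonneg hx] at this

theorem continuousOn_symbol (A : BlockTriple m) : ContinuousOn A.symbol (Set.Ioi 0) := by
  unfold symbol
  refine ContinuousOn.add (ContinuousOn.add ?_ continuousOn_const) ?_
  · exact (continuousOn_inv₀.mono fun x hx => ne_of_gt hx).smul continuousOn_const
  · exact continuousOn_id.smul continuousOn_const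

/-- The matrix `z I - s (A₋₁ + z A₀ + z² A₁)`. -/
noncomputable def scaledMatrix (A : BlockTriple m) (s : ℝ) (z : ℂ) : Matrix (Fin m) (Fin m) ℂ :=
  z • 1 - (s : ℂ) • (A.Am.map Complex.ofReal + z • A.A0.map Complex.ofReal
    + z ^ 2 • A.Ap.map Complex.ofReal)

/-- The polynomial `det (z I - s (A₋₁ + z A₀ + z² A₁))`. As `s` grows from `0` to `1` it deforms
`z ^ m` into `det (z φ(z))`. -/
noncomputable def scaledPoly (A : BlockTriple m) (s : ℝ) : ℂ[X] :=
  Matrix.det ((X : ℂ[X]) • (1 : Matrix (Fin m) (Fin m) ℂ[X])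
    - C (s : ℂ) • (A.Am.map (fun a => C (a : ℂ)) + (X : ℂ[X]) • A.A0.map (fun a => C (a : ℂ))
      + (X ^ 2 : ℂ[X]) • A.Ap.map fun a => C (a : ℂ)))

theorem eval_scaledPoly (A : BlockTriple m) (s : ℝ) (z : ℂ) :
    (A.scaledPoly s).eval z = (A.scaledMatrix s z).det := by
  rw [scaledPoly, ← Polynomial.coe_evalRingHom, RingHom.map_det]
  congr 1
  ext i j
  by_cases h : i = j <;> simp [scaledMatrix, h] <;> ring

theorem continuous_eval_scaledPoly (A : BlockTriple m) :
    Continuous fun x : ℝ × ℂ => (A.scaledPoly x.1).eval x.2 := by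
  simp only [eval_scaledPoly, scaledMatrix]
  refine Continuous.matrix_det ?_
  fun_prop

theorem scaledPoly_one (A : BlockTriple m) : A.scaledPoly 1 = A.charPoly := by
  rw [scaledPoly, charPoly]
  congr 1
  ext1 i j
  by_cases h : i = j <;> simp [h] <;> ring

theorem scaledPoly_zero (A : BlockTriple m) : A.scaledPoly 0 = X ^ m := by
  rw [scaledPoly]
  simp

theorem scaledMatrix_eq (A : BlockTriple m) (s : ℝ) {z : ℂ} (hz : z ≠ 0) :
    A.scaledMatrix s z = z • (1 - (s : ℂ) • A.csymbol z) := by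
  ext i j
  simp [scaledMatrix, csymbol]
  field_simp

theorem eval_scaledPoly_ne_zero_iff (A : BlockTriple m) (s : ℝ) {z : ℂ} (hz : z ≠ 0) :
    (A.scaledPoly s).eval z ≠ 0 ↔ IsUnit (1 - (s : ℂ) • A.csymbol z) := by
  rw [eval_scaledPoly, scaledMatrix_eq A s hz, Matrix.det_smul, Matrix.isUnit_iff_isUnit_det,
    isUnit_iff_ne_zero, mul_ne_zero_iff]
  exact ⟨fun h => h.2, fun h => ⟨pow_ne_zero _ hz, h⟩⟩

theorem eval_scaledPoly_ofReal_ne_zero_iff (A : BlockTriple m) (s : ℝ) {x : ℝ} (hx : x ≠ 0) :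
    (A.scaledPoly s).eval (x : ℂ) ≠ 0 ↔ IsUnit (1 - s • A.symbol x) := by
  rw [eval_scaledPoly_ne_zero_iff A s (Complex.ofReal_ne_zero.2 hx), csymbol_ofReal,
    ← isUnit_map_ofReal_iff]
  have h : (1 - s • A.symbol x).map Complex.ofReal =
      1 - (s : ℂ) • (A.symbol x).map Complex.ofReal := by
    ext i j
    by_cases h : i = j <;> simp [h]
  rw [h]

theorem eval_scaledPoly_ne_zero {A : BlockTriple m} (hA : A.IsNonneg) {s : ℝ} (hs : 0 ≤ s)
    {r : ℝ} (hr : 0 < r) (hsub : IsSubcritical (s • A.symbol r)) {z : ℂ} (hz : ‖z‖ = r) :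
    (A.scaledPoly s).eval z ≠ 0 := by
  rw [eval_scaledPoly_ne_zero_iff A s (norm_pos_iff.1 (hz ▸ hr))]
  refine isUnit_one_sub_of_isSubcritical ?_ hsub
  have := hA.isDominatedBy z
  rw [hz] at this
  exact this.smul (by simp [abs_of_nonneg hs])

/-- If `s A(r)` is subcritical, then `det (z I - s (A₋₁ + z A₀ + z² A₁))` has as many roots in
the disc of radius `r` as `z ^ m`. -/
theorem rootCount_scaledPoly {A : BlockTriple m} (hA : A.IsNonneg) {s : ℝ} (hs : 0 ≤ s)
    {r : ℝ} (hr : 0 < r) (hsub : IsSubcritical (s • A.symbol r)) :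
    rootCount (A.scaledPoly s) r = m := by
  have h := rootCount_eq_of_path hr A.continuous_eval_scaledPoly
    (isPreconnected_Icc (a := (0 : ℝ)) (b := s)) (fun u hu z hz => ?_)
    (Set.right_mem_Icc.2 hs) (Set.left_mem_Icc.2 hs)
  · rw [h, scaledPoly_zero, rootCount, Polynomial.roots_X_pow, Multiset.countP_nsmul]
    rw [Multiset.countP_eq_card.2 (by simpa using hr)]
    simp
  · refine eval_scaledPoly_ne_zero hA hu.1 hr (hsub.mono fun i j => ?_) hz
    exact mul_le_mul_of_nonneg_right hu.2 (hA.symbol_nonneg hr.le i j)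

theorem isSubcritical_smul_symbol_one {A : BlockTriple m} (hA : A.IsQBD) {s : ℝ} (hs : s < 1) :
    IsSubcritical (s • A.symbol 1) := by
  refine ⟨1, fun _ => zero_lt_one, fun i => ?_⟩
  have h : A.symbol 1 *ᵥ 1 = 1 := by
    have := hA.stochastic.2
    rw [symbol, inv_one, one_smul, one_smul]
    exact this
  rw [Matrix.smul_mulVec, h]
  simpa using hs

theorem eigMod_lt_theta {A : BlockTriple m} {t : ℝ} (ht : 1 < t) (h0 : 0 < A.eigMod m)
    (h1 : t < A.eigMod (m + 1) / A.eigMod m) :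
    A.eigMod m < A.theta ∧ A.theta < A.eigMod (m + 1) := by
  have h2 : A.eigMod m < A.eigMod (m + 1) := by
    rw [lt_div_iff₀ h0] at h1
    nlinarith
  refine ⟨Real.lt_sqrt_of_sq_lt (by nlinarith), ?_⟩
  rw [theta, Real.sqrt_lt' (h0.trans h2)]
  nlinarith

/-- Exactly `m` eigenvalues have modulus less than the centring factor. -/
theorem rootCount_charPoly {A : BlockTriple m} {t : ℝ} (ht : 1 < t) (h0 : 0 < A.eigMod m)
    (h1 : t < A.eigMod (m + 1) / A.eigMod m) : 0 < m ∧ rootCount A.charPoly A.theta = m := by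
  obtain ⟨h2, h3⟩ := eigMod_lt_theta ht h0 h1
  have hm : 0 < m := by
    rcases Nat.eq_zero_or_pos m with rfl | h
    · simp [eigMod, charPoly] at h0
    · exact h
  refine ⟨hm, ?_⟩
  unfold eigMod at h2 h3 h0
  rw [Nat.add_sub_cancel] at h3
  set l := (A.charPoly.roots.map fun z => ‖z‖).sort (· ≤ ·) with hl
  have hlen : m < l.length := by
    by_contra h
    rw [List.getD_eq_default _ _ (not_lt.1 h)] at h3
    linarith
  have hc := countP_lt_of_sorted (Multiset.pairwise_sort _ _) hlen hm h2 h3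
  rw [← Multiset.coe_countP, Multiset.sort_eq, Multiset.countP_map] at hc
  rw [rootCount, Multiset.countP_eq_card_filter]
  exact hc

/-- The spectral gap around `θ` forces `A(θ) = θ⁻¹ A₋₁ + A₀ + θ A₁` to be subcritical. Otherwise,
for `s < 1` close to one, `s A(θ)` would not be subcritical while `s A(1)` is, so that
`det (z I - s (A₋₁ + z A₀ + z² A₁))` would have a real root strictly between `1` and `θ`; but it
has `m` roots in the disc of radius `1` and also in that of radius `θ`. -/
theorem isSubcritical_symbol_theta {A : BlockTriple m} (hA : A.IsQBD) {t : ℝ} (ht : 1 < t)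
    (h0 : 0 < A.eigMod m) (h1 : t < A.eigMod (m + 1) / A.eigMod m)
    (hu : ∀ z : ℂ, ‖z‖ = 1 → IsUnit (A.phi (A.theta * z))) :
    IsSubcritical (A.symbol A.theta) := by
  have hA' := hA.isNonneg
  obtain ⟨h2, h3⟩ := eigMod_lt_theta ht h0 h1
  obtain ⟨hm, hcount⟩ := rootCount_charPoly ht h0 h1
  set θ := A.theta with hθ
  have hθ0 : 0 < θ := h0.trans h2
  have hne1 : ∀ z : ℂ, ‖z‖ = θ → (A.scaledPoly 1).eval z ≠ 0 := fun z hz => by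
    rw [eval_scaledPoly_ne_zero_iff A 1 (norm_pos_iff.1 (hz ▸ hθ0)), Complex.ofReal_one,
      one_smul, ← phi_eq_one_sub]
    have hθc : (θ : ℂ) ≠ 0 := Complex.ofReal_ne_zero.2 hθ0.ne'
    have := hu (z / θ) (by
      rw [norm_div, hz, Complex.norm_real, Real.norm_of_nonneg hθ0.le, div_self hθ0.ne'])
    rwa [mul_div_cancel₀ _ hθc] at this
  -- the polynomial stays free of roots on the circle of radius `θ` for `s` in some `[s₀, 1]`
  obtain ⟨s₀, hs0, hs1, hs⟩ : ∃ s₀ : ℝ, 0 ≤ s₀ ∧ s₀ < 1 ∧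
      ∀ s ∈ Set.Icc s₀ 1, ∀ z : ℂ, ‖z‖ = θ → (A.scaledPoly s).eval z ≠ 0 := by
    have hev : ∀ᶠ s in nhds (1 : ℝ), ∀ z ∈ Metric.sphere (0 : ℂ) θ,
        (A.scaledPoly s).eval z ≠ 0 := by
      refine (isCompact_sphere (0 : ℂ) θ).eventually_forall_of_forall_eventually fun z hz => ?_
      exact A.continuous_eval_scaledPoly.continuousAt.eventually_ne (hne1 z (by simpa using hz))
    obtain ⟨ε, hε, hball⟩ := Metric.eventually_nhds_iff.1 hev
    refine ⟨max 0 (1 - ε / 2), le_max_left _ _, max_lt one_pos (by linarith), ?_⟩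
    intro s hs z hz
    refine hball ?_ z (by simpa using hz)
    have : 1 - ε / 2 ≤ s := (le_max_right _ _).trans hs.1
    rw [Real.dist_eq, abs_lt]
    constructor <;> linarith [hs.2]
  have hcountθ : rootCount (A.scaledPoly s₀) θ = m := by
    refine Eq.trans ?_ hcount
    rw [← scaledPoly_one]
    exact rootCount_eq_of_path hθ0 A.continuous_eval_scaledPoly isPreconnected_Icc hs
      (Set.left_mem_Icc.2 hs1.le) (Set.right_mem_Icc.2 hs1.le)
  have hsub1 := isSubcritical_smul_symbol_one hA hs1
  have hcount1 := rootCount_scaledPoly hA' hs0 one_pos hsub1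
  -- it suffices to treat `s₀`, as the path from `s₀` to `1` meets no singular matrix
  suffices h : IsSubcritical (s₀ • A.symbol θ) by
    have := isSubcritical_of_path (B := fun s => s • A.symbol θ)
      (isPreconnected_Icc (a := s₀) (b := 1))
      (continuousOn_id.smul continuousOn_const) (fun s hs' i j => ?_) (fun s hs' => ?_)
      (Set.left_mem_Icc.2 hs1.le) (Set.right_mem_Icc.2 hs1.le) h
    · simpa using this
    · exact mul_nonneg (hs0.trans hs'.1) (hA'.symbol_nonneg hθ0.le i j)
    · rw [← eval_scaledPoly_ofReal_ne_zero_iff A s hθ0.ne']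
      exact hs s hs' _ (by simp [abs_of_pos hθ0])
  by_contra hnot
  obtain ⟨x, hx, hx0⟩ : ∃ x ∈ Set.uIcc 1 θ, (A.scaledPoly s₀).eval (x : ℂ) = 0 := by
    by_contra! hno
    have hpos : Set.uIcc 1 θ ⊆ Set.Ioi 0 := fun x hx => (lt_min one_pos hθ0).trans_le hx.1
    refine hnot (isSubcritical_of_path (B := fun x => s₀ • A.symbol x)
      (S := Set.uIcc 1 θ) isPreconnected_uIcc
      ((A.continuousOn_symbol.mono hpos).const_smul s₀) (fun x hx i j => ?_)
      (fun x hx => ?_) Set.left_mem_uIcc Set.right_mem_uIcc hsub1)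
    · exact mul_nonneg hs0 (hA'.symbol_nonneg (le_of_lt (hpos hx)) i j)
    · exact (eval_scaledPoly_ofReal_ne_zero_iff A s₀ (ne_of_gt (hpos hx))).1 (hno x hx)
  have hx1 : x ≠ 1 := fun h => eval_scaledPoly_ne_zero hA' hs0 one_pos hsub1
    (z := (1 : ℂ)) (by simp) (by simpa [h] using hx0)
  have hxθ : x ≠ θ := fun h => hs s₀ (Set.left_mem_Icc.2 hs1.le) (θ : ℂ)
    (by simp [abs_of_pos hθ0]) (by simpa [h] using hx0)
  have hp0 : A.scaledPoly s₀ ≠ 0 := fun h =>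
    hs s₀ (Set.left_mem_Icc.2 hs1.le) (θ : ℂ) (by simp [abs_of_pos hθ0]) (by simp [h])
  have hroot : (x : ℂ) ∈ (A.scaledPoly s₀).roots := (Polynomial.mem_roots hp0).2 hx0
  have hstrict : ∀ a b : ℝ, 0 < a → a < x → x < b →
      rootCount (A.scaledPoly s₀) a < rootCount (A.scaledPoly s₀) b := fun a b ha hax hxb => by
    obtain ⟨u, hu⟩ := Multiset.exists_cons_of_mem hroot
    have hn : ‖(x : ℂ)‖ = x := by simp [abs_of_pos (ha.trans hax)]
    rw [rootCount, rootCount, hu, Multiset.countP_cons, Multiset.countP_cons, hn, if_pos hxb,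
      if_neg (not_lt.2 hax.le), add_zero, Nat.lt_succ_iff]
    rw [Multiset.countP_eq_card_filter, Multiset.countP_eq_card_filter]
    exact Multiset.card_le_card
      (Multiset.monotone_filter_right _ fun z hz => hz.trans (hax.trans hxb))
  rcases le_total 1 θ with h | h
  · rw [Set.uIcc_of_le h] at hx
    have := hstrict 1 θ one_pos (lt_of_le_of_ne hx.1 hx1.symm) (lt_of_le_of_ne hx.2 hxθ)
    omega
  · rw [Set.uIcc_of_ge h] at hx
    have := hstrict θ 1 hθ0 (lt_of_le_of_ne hx.1 hxθ.symm) (lt_of_le_of_ne hx.2 hx1)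
    omega

end BlockTriple

/-! ### Cyclic reduction -/

/-- `D - E D⁻¹ E = (D - E) D⁻¹ (D + E) = (D + E) D⁻¹ (D - E)` is half the harmonic mean of
`D - E` and `D + E`. -/
theorem schur_inv_eq_half_add {n : Type*} [Fintype n] [DecidableEq n] {D E : Matrix n n ℂ}
    (hD : IsUnit D) (h1 : IsUnit (D - E)) (h2 : IsUnit (D + E)) :
    (D - E * D⁻¹ * E) * ((1 / 2 : ℝ) • (D - E)⁻¹ + (1 / 2 : ℝ) • (D + E)⁻¹) = 1 := by
  rw [Matrix.isUnit_iff_isUnit_det] at hD h1 h2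
  have hD1 := Matrix.mul_nonsing_inv _ hD
  have hD2 := Matrix.nonsing_inv_mul _ hD
  have e1 : D - E * D⁻¹ * E = (D + E) * D⁻¹ * (D - E) := by
    rw [add_mul, hD1, add_mul, one_mul, mul_sub, mul_assoc E D⁻¹ D, hD2, mul_one]
    abel
  have e2 : D - E * D⁻¹ * E = (D - E) * D⁻¹ * (D + E) := by
    rw [sub_mul, hD1, sub_mul, one_mul, mul_add, mul_assoc E D⁻¹ D, hD2, mul_one]
    abel
  have f1 : (D - E * D⁻¹ * E) * (D - E)⁻¹ = (D + E) * D⁻¹ := by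
    rw [e1, mul_assoc, Matrix.mul_nonsing_inv _ h1, mul_one]
  have f2 : (D - E * D⁻¹ * E) * (D + E)⁻¹ = (D - E) * D⁻¹ := by
    rw [e2, mul_assoc, Matrix.mul_nonsing_inv _ h2, mul_one]
  rw [mul_add, mul_smul_comm, mul_smul_comm, f1, f2, ← smul_add, ← add_mul]
  have : D + E + (D - E) = (2 : ℝ) • D := by rw [two_smul]; abel
  rw [this, smul_mul_assoc, hD1, smul_smul]
  norm_num

namespace BlockTriple

variable {m : ℕ}

theorem inv_sub_one (M : Matrix (Fin m) (Fin m) ℝ) (h : IsUnit (1 - M)) :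
    (M - 1)⁻¹ = -(1 - M)⁻¹ := by
  refine Matrix.inv_eq_right_inv ?_
  rw [← neg_sub 1 M, neg_mul_neg, one_sub_mul_inv h]

theorem IsNonneg.A0_le_symbol {A : BlockTriple m} (hA : A.IsNonneg) (i j : Fin m) :
    A.A0 i j ≤ A.symbol 1 i j := by
  have h1 := hA.nonneg_m i j
  have h2 := hA.nonneg_p i j
  simp only [symbol, inv_one, one_smul, Matrix.add_apply]
  linarith

theorem IsNonneg.isSubcritical_A0 {A : BlockTriple m} (hA : A.IsNonneg)
    (hs : IsSubcritical (A.symbol 1)) : IsSubcritical A.A0 :=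
  hs.mono hA.A0_le_symbol

theorem IsNonneg.isUnit_one_sub_A0 {A : BlockTriple m} (hA : A.IsNonneg)
    (hs : IsSubcritical (A.symbol 1)) : IsUnit (1 - A.A0) :=
  isUnit_one_sub_of_isSubcritical (isDominatedBy_self hA.nonneg_0) (hA.isSubcritical_A0 hs)

theorem mul_mul_nonneg {X Y Z : Matrix (Fin m) (Fin m) ℝ} (hX : ∀ i j, 0 ≤ X i j)
    (hY : ∀ i j, 0 ≤ Y i j) (hZ : ∀ i j, 0 ≤ Z i j) (i j : Fin m) : 0 ≤ (X * Y * Z) i j :=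
  (((isDominatedBy_self hX).mul (isDominatedBy_self hY)).mul (isDominatedBy_self hZ)).nonneg i j

theorem IsNonneg.crStep {A : BlockTriple m} (hA : A.IsNonneg) (hs : IsSubcritical (A.symbol 1)) :
    A.crStep.IsNonneg := by
  have hS := inv_one_sub_nonneg hA.nonneg_0 (hA.isSubcritical_A0 hs)
  have e := inv_sub_one A.A0 (hA.isUnit_one_sub_A0 hs)
  refine ⟨fun i j => ?_, fun i j => ?_, fun i j => ?_⟩
  · have := mul_mul_nonneg hA.nonneg_m hS hA.nonneg_m i j
    simpa [BlockTriple.crStep, e] using this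
  · have h1 := mul_mul_nonneg hA.nonneg_p hS hA.nonneg_m i j
    have h2 := mul_mul_nonneg hA.nonneg_m hS hA.nonneg_p i j
    have h3 := hA.nonneg_0 i j
    simp only [BlockTriple.crStep, e, mul_neg, neg_mul, sub_neg_eq_add, Matrix.add_apply]
    linarith
  · have := mul_mul_nonneg hA.nonneg_p hS hA.nonneg_p i j
    simpa [BlockTriple.crStep, e] using this

theorem symbol_one_crStep {A : BlockTriple m} (hu : IsUnit (1 - A.A0)) :
    A.crStep.symbol 1 = A.A0 + (A.Am + A.Ap) * (1 - A.A0)⁻¹ * (A.Am + A.Ap) := by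
  simp only [symbol, BlockTriple.crStep, inv_sub_one A.A0 hu, mul_neg, neg_mul, sub_neg_eq_add,
    neg_neg, inv_one, one_smul, add_mul, mul_add]
  abel

/-- A positive vector `v` with `B v < v` serves for the next step of cyclic reduction too. -/
theorem IsNonneg.isSubcritical_crStep {A : BlockTriple m} (hA : A.IsNonneg)
    (hs : IsSubcritical (A.symbol 1)) : IsSubcritical (A.crStep.symbol 1) := by
  have hu := hA.isUnit_one_sub_A0 hs
  have hS := inv_one_sub_nonneg hA.nonneg_0 (hA.isSubcritical_A0 hs)
  rw [symbol_one_crStep hu]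
  obtain ⟨v, hv, hBv⟩ := hs
  refine ⟨v, hv, fun i => ?_⟩
  set E := A.Am + A.Ap with hE
  have hE0 : ∀ i j, 0 ≤ E i j := fun i j => add_nonneg (hA.nonneg_m i j) (hA.nonneg_p i j)
  have hB : ∀ i, (A.symbol 1 *ᵥ v) i = (A.A0 *ᵥ v) i + (E *ᵥ v) i := fun i => by
    have : A.symbol 1 = A.A0 + E := by
      rw [symbol, inv_one, one_smul, one_smul, hE]
      abel
    rw [this, Matrix.add_mulVec, Pi.add_apply]
  have h1 : ∀ i, (E *ᵥ v) i ≤ ((1 - A.A0) *ᵥ v) i := fun i => by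
    have := hBv i
    rw [hB] at this
    rw [Matrix.sub_mulVec, Matrix.one_mulVec, Pi.sub_apply]
    linarith
  have h2 : ∀ i, ((1 - A.A0)⁻¹ *ᵥ (E *ᵥ v)) i ≤ v i := fun i => by
    have := mulVec_mono_right hS h1 i
    rwa [Matrix.mulVec_mulVec v (1 - A.A0)⁻¹ (1 - A.A0),
      Matrix.nonsing_inv_mul _ ((Matrix.isUnit_iff_isUnit_det _).1 hu), Matrix.one_mulVec] at this
  have h3 := mulVec_mono_right hE0 h2 i
  have h4 := hBv i
  rw [hB] at h4
  rw [Matrix.add_mulVec, Pi.add_apply, ← Matrix.mulVec_mulVec, ← Matrix.mulVec_mulVec]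
  linarith

theorem IsNonneg.isUnit_phi {A : BlockTriple m} (hA : A.IsNonneg)
    (hs : IsSubcritical (A.symbol 1)) {z : ℂ} (hz : ‖z‖ = 1) : IsUnit (A.phi z) := by
  rw [phi_eq_one_sub]
  have := hA.isDominatedBy z
  rw [hz] at this
  exact isUnit_one_sub_of_isSubcritical this hs

/-- The functional equation `2 φ⁽¹⁾(z²)⁻¹ = φ(z)⁻¹ + φ(-z)⁻¹` of cyclic reduction. -/
theorem IsNonneg.inv_phi_crStep {A : BlockTriple m} (hA : A.IsNonneg)
    (hs : IsSubcritical (A.symbol 1)) {z : ℂ} (hz : ‖z‖ = 1) :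
    (A.crStep.phi (z ^ 2))⁻¹ = (1 / 2 : ℝ) • (A.phi z)⁻¹ + (1 / 2 : ℝ) • (A.phi (-z))⁻¹ := by
  have hz0 : z ≠ 0 := norm_pos_iff.1 (by rw [hz]; exact one_pos)
  have hu := hA.isUnit_one_sub_A0 hs
  have h1 := hA.isUnit_phi hs hz
  have h2 := hA.isUnit_phi hs (z := -z) (by rwa [norm_neg])
  set D : Matrix (Fin m) (Fin m) ℂ := (1 - A.A0).map Complex.ofReal with hD
  set E : Matrix (Fin m) (Fin m) ℂ :=
    z⁻¹ • A.Am.map Complex.ofReal + z • A.Ap.map Complex.ofReal with hE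
  have hD' : D = 1 - A.A0.map Complex.ofReal := by
    ext i j
    by_cases h : i = j <;> simp [hD, h]
  have e1 : A.phi z = D - E := by
    rw [hD', hE, phi]
    abel
  have e2 : A.phi (-z) = D + E := by
    rw [hD', hE, phi, inv_neg, neg_smul, neg_smul]
    abel
  have e3 : A.crStep.phi (z ^ 2) = D - E * D⁻¹ * E := by
    rw [hD, map_ofReal_inv hu, hE, ← hD, hD', phi]
    have hmap : ∀ X Y Z : Matrix (Fin m) (Fin m) ℝ, (X * Y * Z).map Complex.ofReal =
        X.map Complex.ofReal * Y.map Complex.ofReal * Z.map Complex.ofReal := fun X Y Z => by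
      exact (map_mul Complex.ofRealHom.mapMatrix (X * Y) Z).trans
        (congrArg (· * _) (map_mul Complex.ofRealHom.mapMatrix X Y))
    have hadd : ∀ X Y : Matrix (Fin m) (Fin m) ℝ, (X + Y).map Complex.ofReal =
        X.map Complex.ofReal + Y.map Complex.ofReal := fun X Y =>
      Matrix.map_add _ Complex.ofReal_add X Y
    simp only [BlockTriple.crStep, inv_sub_one A.A0 hu, mul_neg, neg_mul, sub_neg_eq_add,
      neg_neg, hmap, hadd, add_mul, mul_add, smul_mul_assoc, mul_smul_comm, smul_add, smul_smul,
      inv_mul_cancel₀ hz0, mul_inv_cancel₀ hz0, one_smul]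
    rw [pow_two, mul_inv]
    abel
  rw [e3, e1, e2]
  rw [e1] at h1
  rw [e2] at h2
  exact Matrix.inv_eq_right_inv
    (schur_inv_eq_half_add (isUnit_map_ofReal_iff.2 hu) h1 h2)

/-- The values of `φ⁻¹` on the unit circle. -/
def circleInverses (A : BlockTriple m) : Set (Matrix (Fin m) (Fin m) ℂ) :=
  (fun z => (A.phi z)⁻¹) '' Metric.sphere (0 : ℂ) 1

/-- Cyclic reduction keeps the blocks nonnegative and the symbol subcritical. On the unit circle
the inverse of `φ⁽ʰ⁾` is a mean of `2 ^ h` values of `φ⁻¹`; only its membership in their convex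
hull is recorded. -/
theorem IsNonneg.cr {A : BlockTriple m} (hA : A.IsNonneg) (hs : IsSubcritical (A.symbol 1))
    (h : ℕ) : (A.cr h).IsNonneg ∧ IsSubcritical ((A.cr h).symbol 1) ∧
      ∀ z : ℂ, ‖z‖ = 1 → ((A.cr h).phi z)⁻¹ ∈ convexHull ℝ A.circleInverses := by
  induction h with
  | zero =>
    exact ⟨hA, hs, fun z hz => subset_convexHull ℝ _ ⟨z, by simpa using hz, rfl⟩⟩
  | succ h ih =>
    obtain ⟨h1, h2, h3⟩ := ih
    have e : A.cr (h + 1) = (A.cr h).crStep := Function.iterate_succ_apply' _ _ _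
    rw [e]
    refine ⟨h1.crStep h2, h1.isSubcritical_crStep h2, fun w hw => ?_⟩
    obtain ⟨z, rfl⟩ := IsAlgClosed.exists_pow_nat_eq w (n := 2) two_pos
    have hz : ‖z‖ = 1 := by
      rw [norm_pow] at hw
      exact (pow_eq_one_iff_of_nonneg (norm_nonneg z) two_ne_zero).1 hw
    rw [h1.inv_phi_crStep h2 hz]
    exact (convex_convexHull ℝ _) (h3 z hz) (h3 (-z) (by rwa [norm_neg]))
      (by norm_num) (by norm_num) (by norm_num)

end BlockTriple

/-! ### Off-diagonal blocks of an inverse -/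

/-- For complementary idempotents `P`, `Q` and mutually inverse `M`, `N`, the block `Q M P` is a
multiple of `Q N P`; the right factor is the Schur complement of `Q M Q` in `M`, which inverts
`P N P`. -/
theorem offDiagonal_eq_mul_offDiagonal_inv {R : Type*} [Ring R] {P Q M N D : R} (hP : P * P = P)
    (hQ : Q = 1 - P)     (hMN : M * N = 1) (hNM : N * M = 1)
    (hD : (1 - Q * (1 - M) * Q) * D = 1) :
    Q * M * P = -(Q * M * Q) * (Q * N * P) * (P * M * P - P * M * Q * D * Q * M * P) := by
  have hPQ : P + Q = 1 := by rw [hQ]; abel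
  have hQQ : Q * Q = Q := by rw [hQ, mul_sub, mul_one, sub_mul, one_mul, hP, sub_self, sub_zero]
  have hQP : Q * P = 0 := by rw [hQ, sub_mul, hP, one_mul, sub_self]
  have hPQ0 : P * Q = 0 := by rw [hQ, mul_sub, hP, mul_one, sub_self]
  have e : 1 - Q * (1 - M) * Q = P + Q * M * Q := by
    rw [mul_sub, mul_one, sub_mul, hQQ, ← hPQ]
    abel
  rw [e] at hD
  have f1 : Q * M * Q * D = Q := by
    have := congrArg (Q * ·) hD
    simp only [mul_one, add_mul, mul_add] at this
    rwa [← mul_assoc Q P D, hQP, zero_mul, zero_add, ← mul_assoc Q, ← mul_assoc Q, ← mul_assoc Q,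
      hQQ] at this
  set W := P * M * P - P * M * Q * D * Q * M * P with hW
  have f2 : P * N * P * M * Q = -(P * N * Q * M * Q) := by
    have : P * N * (P + Q) * M * Q = 0 := by
      rw [hPQ, mul_one, mul_assoc P, hNM, mul_one, hPQ0]
    rw [eq_neg_iff_add_eq_zero, ← this]
    noncomm_ring
  have f3 : P * N * P * W = P := by
    have : P * N * P * W = P * N * (P * P) * M * P - P * N * (P * P) * M * Q * D * Q * M * P := by
      rw [hW]
      noncomm_ring
    rw [this, hP, f2]
    have : -(P * N * Q * M * Q) * D * Q * M * P = -(P * N * (Q * Q) * M * Q * D * Q * M * P) := by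
      rw [hQQ]
      noncomm_ring
    rw [this]
    have : P * N * (Q * Q) * M * Q * D * Q * M * P =
        P * N * Q * (Q * M * Q * D) * Q * M * P := by noncomm_ring
    rw [this, f1]
    have : P * N * Q * Q * Q * M * P = P * N * Q * M * P := by
      rw [mul_assoc (P * N) Q Q, hQQ, mul_assoc (P * N) Q Q, hQQ]
    rw [this]
    have : P * N * P * M * P - -(P * N * Q * M * P) = P * N * (P + Q) * M * P := by noncomm_ring
    rw [this, hPQ, mul_one, mul_assoc P, hNM, mul_one, hP]
  have f4 : Q * M * P * N * P = -(Q * M * Q * N * P) := by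
    have : Q * M * (P + Q) * N * P = 0 := by
      rw [hPQ, mul_one, mul_assoc Q, hMN, mul_one, hQP]
    rw [eq_neg_iff_add_eq_zero, ← this]
    noncomm_ring
  calc Q * M * P = Q * M * (P * N * P * W) := by rw [f3]
    _ = Q * M * P * N * P * W := by noncomm_ring
    _ = -(Q * M * Q * N * P) * W := by rw [f4]
    _ = -(Q * M * (Q * Q) * N * P) * W := by rw [hQQ]
    _ = _ := by noncomm_ring

/-! ### Laurent coefficients of the Neumann series -/

theorem hasSum_nat_geometric_tail {q : ℝ} (hq0 : 0 ≤ q) (hq1 : q < 1) (a : ℕ) :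
    HasSum (fun k : ℕ => if k < a then 0 else q ^ k) (q ^ a / (1 - q)) := by
  rw [← hasSum_nat_add_iff' a]
  have h : ∑ i ∈ Finset.range a, (if i < a then (0 : ℝ) else q ^ i) = 0 :=
    Finset.sum_eq_zero fun i hi => if_pos (Finset.mem_range.1 hi)
  rw [h, sub_zero]
  simpa [pow_add, mul_comm, div_eq_mul_inv] using
    (hasSum_geometric_of_lt_one hq0 hq1).mul_left (q ^ a)

/-- The tail of a bilateral series with geometrically decaying terms. -/
theorem norm_sub_sum_Icc_le {V : Type*} [NormedAddCommGroup V] {f : ℤ → V}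
    {S : V} (hf : HasSum f S) {c q : ℝ} (hq0 : 0 ≤ q) (hq1 : q < 1)
    (hfc : ∀ j, ‖f j‖ ≤ c * q ^ j.natAbs) (n : ℕ) :
    ‖S - ∑ j ∈ Finset.Icc (-(n : ℤ)) n, f j‖ ≤ 2 * c * q ^ (n + 1) / (1 - q) := by
  have hmem : ∀ j : ℤ, j ∈ Finset.Icc (-(n : ℤ)) n ↔ j.natAbs < n + 1 := fun j => by
    rw [Finset.mem_Icc]
    omega
  have hf' : HasSum (fun j => if j ∈ Finset.Icc (-(n : ℤ)) n then f j else 0)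
      (∑ j ∈ Finset.Icc (-(n : ℤ)) n, f j) := by
    have h := hasSum_sum_of_ne_finset_zero (L := .unconditional ℤ)
      (f := fun j => if j ∈ Finset.Icc (-(n : ℤ)) n then f j else 0)
      (s := Finset.Icc (-(n : ℤ)) n) fun j hj => if_neg hj
    rwa [Finset.sum_congr rfl fun j hj => if_pos hj] at h
  have hg : HasSum (fun j : ℤ => c * if j.natAbs < n + 1 then 0 else q ^ j.natAbs)
      (c * (q ^ (n + 1) / (1 - q) + q ^ (n + 1) / (1 - q))) := by
    refine HasSum.mul_left c (HasSum.of_nat_of_neg_add_one ?_ ?_)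
    · simpa using hasSum_nat_geometric_tail hq0 hq1 (n + 1)
    · have h := (hasSum_nat_add_iff' 1).2 (hasSum_nat_geometric_tail hq0 hq1 (n + 1))
      simp only [Finset.sum_range_one, Nat.succ_pos, if_true, sub_zero] at h
      have e : ∀ k : ℕ, (-((k : ℤ) + 1)).natAbs = k + 1 := fun k => by omega
      simpa only [e] using h
  refine ((hf.sub hf').norm_le_of_bounded hg fun j => ?_).trans (le_of_eq (by ring))
  by_cases h : j ∈ Finset.Icc (-(n : ℤ)) n
  · rw [if_pos h, if_pos ((hmem j).1 h)]
    simp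
  · rw [if_neg h, if_neg (fun h' => h ((hmem j).2 h')), sub_zero]
    exact hfc j

namespace BlockTriple

variable {m : ℕ}

/-- The coefficient of `z ^ j` in the matrix Laurent polynomial
`(z⁻¹ A₋₁ + A₀ + z A₁) ^ l`. -/
noncomputable def powCoeff (A : BlockTriple m) : ℕ → ℤ → Matrix (Fin m) (Fin m) ℝ
  | 0, j => if j = 0 then 1 else 0
  | l + 1, j => A.Am * powCoeff A l (j + 1) + A.A0 * powCoeff A l j + A.Ap * powCoeff A l (j - 1)

theorem IsNonneg.powCoeff_nonneg {A : BlockTriple m} (hA : A.IsNonneg) (l : ℕ) :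
    ∀ (j : ℤ) (a b : Fin m), 0 ≤ A.powCoeff l j a b := by
  induction l with
  | zero =>
    intro j a b
    rw [powCoeff]
    split_ifs
    · exact (isDominatedBy_one (𝕜 := ℝ)).nonneg a b
    · exact le_rfl
  | succ l ih =>
    intro j
    exact ((((isDominatedBy_self hA.nonneg_m).mul (isDominatedBy_self (ih (j + 1)))).add
      ((isDominatedBy_self hA.nonneg_0).mul (isDominatedBy_self (ih j)))).add
      ((isDominatedBy_self hA.nonneg_p).mul (isDominatedBy_self (ih (j - 1))))).nonneg

theorem hasSum_powCoeff (A : BlockTriple m) {z : ℂ} (hz : z ≠ 0) (l : ℕ) :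
    HasSum (fun j : ℤ => z ^ j • (A.powCoeff l j).map Complex.ofReal) (A.csymbol z ^ l) := by
  induction l with
  | zero =>
    have h := hasSum_single (f := fun j : ℤ => z ^ j • (A.powCoeff 0 j).map Complex.ofReal) 0
      fun j hj => by simp [powCoeff, hj]
    simpa [powCoeff, Matrix.map_one] using h
  | succ l ih =>
    have hm := ((Equiv.addRight (1 : ℤ)).hasSum_iff.2 ih).mul_left
      (z⁻¹ • A.Am.map Complex.ofReal)
    have h0 := ih.mul_left (A.A0.map Complex.ofReal)
    have hp := ((Equiv.addRight (-1 : ℤ)).hasSum_iff.2 ih).mul_left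
      (z • A.Ap.map Complex.ofReal)
    have e : A.csymbol z ^ (l + 1) = z⁻¹ • A.Am.map Complex.ofReal * A.csymbol z ^ l +
        A.A0.map Complex.ofReal * A.csymbol z ^ l +
        z • A.Ap.map Complex.ofReal * A.csymbol z ^ l := by
      rw [pow_succ', ← add_mul, ← add_mul]
      rfl
    rw [e]
    refine ((hm.add h0).add hp).congr_fun fun j => ?_
    have hmap : ∀ X Y : Matrix (Fin m) (Fin m) ℝ, (X * Y).map Complex.ofReal =
        X.map Complex.ofReal * Y.map Complex.ofReal := fun X Y =>
      map_mul Complex.ofRealHom.mapMatrix X Y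
    have hadd : ∀ X Y : Matrix (Fin m) (Fin m) ℝ, (X + Y).map Complex.ofReal =
        X.map Complex.ofReal + Y.map Complex.ofReal := fun X Y =>
      Matrix.map_add _ Complex.ofReal_add X Y
    have e1 : z ^ (j + 1) * z⁻¹ = z ^ j := by
      rw [zpow_add_one₀ hz, mul_assoc, mul_inv_cancel₀ hz, mul_one]
    have e2 : z ^ (j + -1) * z = z ^ j := by
      rw [← sub_eq_add_neg, zpow_sub_one₀ hz, mul_assoc, inv_mul_cancel₀ hz, mul_one]
    simp only [powCoeff, Function.comp_apply, Equiv.coe_addRight, hmap, hadd, smul_add,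
      smul_mul_assoc, mul_smul_comm, smul_smul, e1, e2, sub_eq_add_neg]

/-- The coefficient of `z ^ j` in the partial sum `∑ l < L, (z⁻¹ A₋₁ + A₀ + z A₁) ^ l` of the
Neumann series. -/
noncomputable def neumannCoeff (A : BlockTriple m) (L : ℕ) (j : ℤ) :
    Matrix (Fin m) (Fin m) ℝ :=
  ∑ l ∈ Finset.range L, A.powCoeff l j

theorem IsNonneg.neumannCoeff_nonneg {A : BlockTriple m} (hA : A.IsNonneg) (L : ℕ) (j : ℤ)
    (a b : Fin m) : 0 ≤ A.neumannCoeff L j a b := by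
  rw [neumannCoeff, Matrix.sum_apply]
  exact Finset.sum_nonneg fun l _ => hA.powCoeff_nonneg l j a b

theorem hasSum_neumannCoeff (A : BlockTriple m) {z : ℂ} (hz : z ≠ 0) (L : ℕ) :
    HasSum (fun j : ℤ => z ^ j • (A.neumannCoeff L j).map Complex.ofReal)
      (∑ l ∈ Finset.range L, A.csymbol z ^ l) := by
  refine (hasSum_sum fun l _ => A.hasSum_powCoeff hz l).congr_fun fun j => ?_
  rw [← Finset.smul_sum, neumannCoeff]
  congr 1
  exact map_sum Complex.ofRealHom.mapMatrix _ _

/-- The terms of the Neumann series are nonnegative at a positive argument, so each of them is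
bounded by the sum of the series. -/
theorem IsNonneg.neumannCoeff_le {A : BlockTriple m} (hA : A.IsNonneg) {x : ℝ} (hx : 0 < x)
    (L : ℕ) (j : ℤ) (a b : Fin m) :
    x ^ j * A.neumannCoeff L j a b ≤ (∑ l ∈ Finset.range L, A.symbol x ^ l) a b := by
  have h := A.hasSum_neumannCoeff (Complex.ofReal_ne_zero.2 hx.ne') L
  have e : ∑ l ∈ Finset.range L, A.csymbol x ^ l =
      (∑ l ∈ Finset.range L, A.symbol x ^ l).map Complex.ofReal := by
    rw [csymbol_ofReal]
    have := map_sum Complex.ofRealHom.mapMatrix (fun l => A.symbol x ^ l) (Finset.range L)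
    simp only [map_pow] at this
    exact this.symm
  rw [e] at h
  have h2 := Pi.hasSum.1 (Pi.hasSum.1 h a) b
  have h3 : HasSum (fun j : ℤ => ((x ^ j * A.neumannCoeff L j a b : ℝ) : ℂ))
      (((∑ l ∈ Finset.range L, A.symbol x ^ l) a b : ℝ) : ℂ) := by
    refine h2.congr_fun fun j => ?_
    simp
  exact le_hasSum (Complex.hasSum_ofReal.1 h3) j fun i _ =>
    mul_nonneg (zpow_nonneg hx.le i) (hA.neumannCoeff_nonneg L i a b)

theorem IsNonneg.norm_neumannCoeff_le {A : BlockTriple m} (hA : A.IsNonneg) {x : ℝ} (hx : 0 < x)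
    {B : Matrix (Fin m) (Fin m) ℝ} (hB : IsSubcritical B)
    (hAB : ∀ a b, A.symbol x a b ≤ B a b) (L : ℕ) (j : ℤ) :
    x ^ j * ‖A.neumannCoeff L j‖ ≤ ‖(1 - B)⁻¹‖ := by
  have hd : IsDominatedBy (A.symbol x) B :=
    (isDominatedBy_self (hA.symbol_nonneg hx.le)).trans hAB
  have h : ‖x ^ j • A.neumannCoeff L j‖ ≤ ‖(1 - B)⁻¹‖ := by
    refine norm_le_of_entry_le
      (fun a b => mul_nonneg (zpow_nonneg hx.le j) (hA.neumannCoeff_nonneg L j a b))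
      fun a b => (hA.neumannCoeff_le hx L j a b).trans ?_
    exact (le_abs_self _).trans ((hd.geom_sum L a b).trans
      (geom_sum_le_inv hd.nonneg hB L a b))
  rwa [norm_smul, Real.norm_of_nonneg (zpow_nonneg hx.le j)] at h

/-- Evaluating at `t` and at `t⁻¹` gives the decay of the coefficients in both directions. -/
theorem IsNonneg.norm_neumannCoeff_le_pow {A : BlockTriple m} (hA : A.IsNonneg) {t δ : ℝ}
    (ht : 0 < t) {B B' : Matrix (Fin m) (Fin m) ℝ} (hB : IsSubcritical B)
    (hAB : ∀ a b, A.symbol t a b ≤ B a b) (hBδ : ‖(1 - B)⁻¹‖ ≤ δ) (hB' : IsSubcritical B')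
    (hAB' : ∀ a b, A.symbol t⁻¹ a b ≤ B' a b) (hBδ' : ‖(1 - B')⁻¹‖ ≤ δ) (L : ℕ) (j : ℤ) :
    ‖A.neumannCoeff L j‖ ≤ δ * t⁻¹ ^ j.natAbs := by
  rw [inv_pow, ← div_eq_mul_inv, le_div_iff₀ (pow_pos ht _), mul_comm]
  obtain ⟨n, rfl | rfl⟩ := j.eq_nat_or_neg
  · simpa using (hA.norm_neumannCoeff_le ht hB hAB L (n : ℤ)).trans hBδ
  · simpa using (hA.norm_neumannCoeff_le (inv_pos.2 ht) hB' hAB' L (-(n : ℤ))).trans hBδ'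

end BlockTriple

/-! ### Low-rank approximation of the off-diagonal blocks of the inverse -/

/-- An off-diagonal block of `(I - X)⁻¹`, with the inverse of the diagonal block `I - P X P`
replaced by a partial sum of its Neumann series. -/
theorem offDiagonal_inv_eq {R : Type*} [Ring R] {P Q X N : R} (hP : P * P = P) (hQ : Q = 1 - P)
    (hN : N * (1 - X) = 1) (L : ℕ) :
    Q * N * P = Q * N * (Q * X * P) * ∑ l ∈ Finset.range L, (P * X * P) ^ l
      + Q * N * P * (P * X * P) ^ L := by
  have hPQ : P + Q = 1 := by rw [hQ]; abel
  have hQP : Q * P = 0 := by rw [hQ, sub_mul, hP, one_mul, sub_self]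
  have h1 : Q * N * P * (1 - P * X * P) = Q * N * (Q * X * P) := by
    have h2 : Q * N * (P + Q) * (1 - X) * P = 0 := by
      rw [hPQ, mul_one, mul_assoc Q, hN, mul_one, hQP]
    have h3 : Q * N * (P + Q) * (1 - X) * P = Q * N * (P * P) - Q * N * P * X * P
        + Q * N * (Q * P) - Q * N * Q * X * P := by noncomm_ring
    rw [h3, hP, hQP, mul_zero, add_zero] at h2
    rw [mul_sub, mul_one, mul_assoc P X P, ← mul_assoc (Q * N * P) P, mul_assoc (Q * N) P P, hP,
      ← sub_eq_zero, ← h2]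
    noncomm_ring
  rw [← h1, mul_assoc _ (1 - P * X * P), mul_neg_geom_sum]
  noncomm_ring

theorem convex_setOf_near {n ι κ : Type*} [Fintype n] [DecidableEq n] [Fintype κ]
    (P Q : Matrix n n ℂ) (S : Finset ι) (E : κ → Matrix n n ℂ) (g : ι → Matrix n n ℂ) (ε : ℝ) :
    Convex ℝ {Y : Matrix n n ℂ | ∃ X : ι → κ → Matrix n n ℂ,
      ‖Q * Y * P - ∑ j ∈ S, (∑ i, X j i * E i) * g j‖ ≤ ε} := by
  rintro Y ⟨X, hX⟩ Y' ⟨X', hX'⟩ a b ha hb hab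
  refine ⟨fun j i => a • X j i + b • X' j i, ?_⟩
  have e : Q * (a • Y + b • Y') * P
      - ∑ j ∈ S, (∑ i, (a • X j i + b • X' j i) * E i) * g j
      = a • (Q * Y * P - ∑ j ∈ S, (∑ i, X j i * E i) * g j)
        + b • (Q * Y' * P - ∑ j ∈ S, (∑ i, X' j i * E i) * g j) := by
    simp only [add_mul, mul_add, smul_mul_assoc, mul_smul_comm, Finset.sum_add_distrib,
      ← Finset.smul_sum, smul_sub]
    abel
  rw [e]
  calc _ ≤ a * ε + b * ε := by
        refine (norm_add_le _ _).trans (add_le_add ?_ ?_)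
        · rw [norm_smul, Real.norm_of_nonneg ha]
          exact mul_le_mul_of_nonneg_left hX ha
        · rw [norm_smul, Real.norm_of_nonneg hb]
          exact mul_le_mul_of_nonneg_left hX' hb
    _ = ε := by rw [← add_mul, hab, one_mul]

theorem norm_coordProj_mul_le {m : ℕ} (K : Finset (Fin m)) {X : Matrix (Fin m) (Fin m) ℂ} {c : ℝ}
    (hX : ‖X‖ ≤ c) : ‖coordProj K * X‖ ≤ c := by
  simpa using norm_mul_le_of_le (norm_coordProj_le K) hX

theorem norm_mul_coordProj_le {m : ℕ} (K : Finset (Fin m)) {X : Matrix (Fin m) (Fin m) ℂ} {c : ℝ}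
    (hX : ‖X‖ ≤ c) : ‖X * coordProj K‖ ≤ c := by
  simpa using norm_mul_le_of_le hX (norm_coordProj_le K)

theorem IsDominatedBy.coordProj {m : ℕ} (K K' : Finset (Fin m)) {X : Matrix (Fin m) (Fin m) ℂ}
    {B : Matrix (Fin m) (Fin m) ℝ} (h : IsDominatedBy X B) :
    IsDominatedBy (coordProj K * X * coordProj K') B := by
  intro i j
  rw [coordProj_mul_mul_apply]
  split_ifs
  · exact h i j
  · simpa using h.nonneg i j

namespace BlockTriple

variable {m : ℕ}

/-- The triple of the diagonal blocks with index set `K`, padded with zeros. -/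
def restrict (A : BlockTriple m) (K : Finset (Fin m)) : BlockTriple m where
  Am := Matrix.of fun i j => if i ∈ K ∧ j ∈ K then A.Am i j else 0
  A0 := Matrix.of fun i j => if i ∈ K ∧ j ∈ K then A.A0 i j else 0
  Ap := Matrix.of fun i j => if i ∈ K ∧ j ∈ K then A.Ap i j else 0

theorem csymbol_restrict (A : BlockTriple m) (K : Finset (Fin m)) (z : ℂ) :
    (A.restrict K).csymbol z = coordProj K * A.csymbol z * coordProj K := by
  ext i j
  rw [coordProj_mul_mul_apply]
  by_cases h : i ∈ K ∧ j ∈ K <;> simp [csymbol, restrict, h]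

theorem IsNonneg.restrict {A : BlockTriple m} (hA : A.IsNonneg) (K : Finset (Fin m)) :
    (A.restrict K).IsNonneg where
  nonneg_m i j := by
    simp only [BlockTriple.restrict, Matrix.of_apply]
    split_ifs
    exacts [hA.nonneg_m i j, le_rfl]
  nonneg_0 i j := by
    simp only [BlockTriple.restrict, Matrix.of_apply]
    split_ifs
    exacts [hA.nonneg_0 i j, le_rfl]
  nonneg_p i j := by
    simp only [BlockTriple.restrict, Matrix.of_apply]
    split_ifs
    exacts [hA.nonneg_p i j, le_rfl]

theorem IsNonneg.symbol_restrict_le {A : BlockTriple m} (hA : A.IsNonneg) (K : Finset (Fin m))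
    {x : ℝ} (hx : 0 ≤ x) (i j : Fin m) : (A.restrict K).symbol x i j ≤ A.symbol x i j := by
  by_cases h : i ∈ K ∧ j ∈ K
  · simp [symbol, BlockTriple.restrict, h]
  · have := hA.symbol_nonneg hx i j
    simpa [symbol, BlockTriple.restrict, h] using this

/-- On the annulus `t⁻¹ ≤ |z| ≤ t` the symbol is subcritical and `δ` bounds the inverse of
`I - A(z)`; by domination it is enough to ask this for real arguments. -/
def IsBoundedOn (A : BlockTriple m) (t δ : ℝ) : Prop :=
  ∀ x : ℝ, t⁻¹ ≤ x → x ≤ t → IsSubcritical (A.symbol x) ∧ ‖(1 - A.symbol x)⁻¹‖ ≤ δ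

theorem norm_inv_phi_le {A : BlockTriple m} (hA : A.IsNonneg) {δ : ℝ}
    (hs : IsSubcritical (A.symbol 1)) (hδ : ‖(1 - A.symbol 1)⁻¹‖ ≤ δ) {z : ℂ} (hz : ‖z‖ = 1) :
    ‖(A.phi z)⁻¹‖ ≤ δ := by
  have h := hA.isDominatedBy z
  rw [hz] at h
  rw [phi_eq_one_sub]
  exact (h.inv_one_sub hs).norm_le.trans hδ

theorem norm_csymbol_le {A : BlockTriple m} (hA : A.IsNonneg) {δ : ℝ}
    (hs : IsSubcritical (A.symbol 1)) (hδ : ‖(1 - A.symbol 1)⁻¹‖ ≤ δ) {z : ℂ} (hz : ‖z‖ = 1) :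
    ‖A.csymbol z‖ ≤ δ := by
  have h := hA.isDominatedBy z
  rw [hz] at h
  exact h.norm_le.trans
    ((norm_le_of_entry_le h.nonneg (le_inv_one_sub h.nonneg hs)).trans hδ)

/-- Every matrix in the convex hull of the values of `φ⁻¹` on the unit circle has an off-diagonal
block close to a matrix of rank at most `3 k (2 n + 1)`. Up to a small error, that block of
`φ(z)⁻¹` is `∑ |j| ≤ n, ∑ i, X i j (Q A i P) g j`, where only the coefficients `X i j` depend
on `z`; so the approximation passes to convex combinations without an increase of the rank. -/
theorem exists_rank_le_norm_sub_le {A : BlockTriple m} (hA : A.IsNonneg) {t δ : ℝ} (ht : 1 < t)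
    (hbd : A.IsBoundedOn t δ) {k : ℕ} {K : Finset (Fin m)}
    (hm : (block A.Am Kᶜ K).rank ≤ k) (h0 : (block A.A0 Kᶜ K).rank ≤ k)
    (hp : (block A.Ap Kᶜ K).rank ≤ k) (n : ℕ) {ε : ℝ} (hε : 0 < ε)
    {Y : Matrix (Fin m) (Fin m) ℂ} (hY : Y ∈ convexHull ℝ A.circleInverses) :
    ∃ Λ : Matrix (Fin m) (Fin m) ℂ, Λ.rank ≤ 3 * k * (2 * n + 1) ∧
      ‖coordProj Kᶜ * Y * coordProj K - Λ‖ ≤ 2 * δ ^ 3 * t⁻¹ ^ (n + 1) / (1 - t⁻¹) + ε := by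
  have ht0 : 0 < t := one_pos.trans ht
  have hti : t⁻¹ < 1 := inv_lt_one_of_one_lt₀ ht
  obtain ⟨hs1, hδ1⟩ := hbd 1 hti.le ht.le
  obtain ⟨hst, hδt⟩ := hbd t (hti.le.trans ht.le) le_rfl
  obtain ⟨hst', hδt'⟩ := hbd t⁻¹ le_rfl (hti.le.trans ht.le)
  set P := coordProj K with hPdef
  set Q := coordProj Kᶜ with hQdef
  have hPP : P * P = P := coordProj_mul_self K
  have hQ : Q = 1 - P := coordProj_compl K
  -- a partial sum of the Neumann series that is uniformly accurate on the unit circle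
  obtain ⟨L, hL⟩ : ∃ L : ℕ, δ * ‖A.symbol 1 ^ L‖ ≤ ε := by
    have h := (tendsto_pow_of_isSubcritical
      (isDominatedBy_self (hA.symbol_nonneg zero_le_one)) hs1).norm.const_mul δ
    rw [norm_zero, mul_zero] at h
    obtain ⟨L, hL⟩ := (h.eventually (gt_mem_nhds hε)).exists
    exact ⟨L, hL.le⟩
  let E : Fin 3 → Matrix (Fin m) (Fin m) ℂ := ![Q * A.Am.map Complex.ofReal * P,
    Q * A.A0.map Complex.ofReal * P, Q * A.Ap.map Complex.ofReal * P]
  let g : ℤ → Matrix (Fin m) (Fin m) ℂ :=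
    fun j => ((A.restrict K).neumannCoeff L j).map Complex.ofReal
  have hg : ∀ j, ‖g j‖ ≤ δ * t⁻¹ ^ j.natAbs := fun j =>
    (isDominatedBy_map_ofReal ((hA.restrict K).neumannCoeff_nonneg L j)).norm_le.trans
      ((hA.restrict K).norm_neumannCoeff_le_pow ht0 hst (hA.symbol_restrict_le K ht0.le) hδt
        hst' (hA.symbol_restrict_le K (inv_pos.2 ht0).le) hδt' L j)
  have hnear := convexHull_min (𝕜 := ℝ) (s := A.circleInverses) ?_
    (convex_setOf_near P Q (Finset.Icc (-(n : ℤ)) n) E g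
      (2 * δ ^ 3 * t⁻¹ ^ (n + 1) / (1 - t⁻¹) + ε)) hY
  · obtain ⟨X, hX⟩ := hnear
    refine ⟨_, ?_, hX⟩
    have hE : ∀ i, (E i).rank ≤ k := by
      have hb : ∀ M : Matrix (Fin m) (Fin m) ℝ, (block M Kᶜ K).rank ≤ k →
          (Q * M.map Complex.ofReal * P).rank ≤ k := fun M hM =>
        (rank_coordProj_mul_mul_le _ _ _).trans ((rank_map_ofReal_le (block M Kᶜ K)).trans hM)
      intro i
      fin_cases i
      exacts [hb _ hm, hb _ h0, hb _ hp]
    refine (rank_sum_le (r := 3 * k) _ _ fun j _ => ?_).trans (le_of_eq ?_)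
    · refine (Matrix.rank_mul_le_left _ _).trans ?_
      refine (rank_sum_le (r := k) _ _ fun i _ =>
        (Matrix.rank_mul_le_right _ _).trans (hE i)).trans ?_
      simp
    · rw [Int.card_Icc, mul_comm]
      congr 1
      omega
  · rintro _ ⟨z, hz, rfl⟩
    have hz1 : ‖z‖ = 1 := by simpa using hz
    have hz0 : z ≠ 0 := norm_pos_iff.1 (by rw [hz1]; exact one_pos)
    have hN : (A.phi z)⁻¹ * (1 - A.csymbol z) = 1 := by
      rw [← phi_eq_one_sub]
      exact Matrix.nonsing_inv_mul _ ((Matrix.isUnit_iff_isUnit_det _).1 (hA.isUnit_phi hs1 hz1))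
    have hNδ := norm_inv_phi_le hA hs1 hδ1 hz1
    set N := (A.phi z)⁻¹ with hNdef
    let c : Fin 3 → ℂ := ![z⁻¹, 1, z]
    refine ⟨fun j i => (z ^ j * c i) • (Q * N), ?_⟩
    have hC : Q * A.csymbol z * P = ∑ i, c i • E i := by
      simp only [Fin.sum_univ_three, c, E, csymbol, mul_add, add_mul, mul_smul_comm,
        smul_mul_assoc]
      simp
    have hsum : ∑ j ∈ Finset.Icc (-(n : ℤ)) n, (∑ i, (z ^ j * c i) • (Q * N) * E i) * g j =
        Q * N * (Q * A.csymbol z * P) * ∑ j ∈ Finset.Icc (-(n : ℤ)) n, z ^ j • g j := by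
      rw [Finset.mul_sum]
      refine Finset.sum_congr rfl fun j _ => ?_
      rw [hC, mul_smul_comm, ← smul_mul_assoc, Finset.mul_sum, Finset.smul_sum]
      simp only [smul_mul_assoc, mul_smul_comm, smul_smul]
    have hG := (A.restrict K).hasSum_neumannCoeff hz0 L
    rw [csymbol_restrict] at hG
    have htail := norm_sub_sum_Icc_le hG (inv_pos.2 ht0).le hti (c := δ) (fun j => by
      rw [norm_smul, norm_zpow, hz1, _root_.one_zpow, one_mul]
      exact hg j) n
    change ‖Q * N * P - _‖ ≤ _
    rw [hsum, offDiagonal_inv_eq hPP hQ hN L, add_sub_right_comm, ← mul_sub]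
    refine (norm_add_le _ _).trans (add_le_add ?_ ?_)
    · have h1 : ‖Q * N * (Q * A.csymbol z * P)‖ ≤ δ * δ :=
        norm_mul_le_of_le (norm_coordProj_mul_le _ hNδ) (norm_mul_coordProj_le _
          (norm_coordProj_mul_le _ (norm_csymbol_le hA hs1 hδ1 hz1)))
      refine (norm_mul_le_of_le h1 htail).trans (le_of_eq ?_)
      ring
    · have h2 := hA.isDominatedBy z
      rw [hz1] at h2
      exact (norm_mul_le_of_le (norm_mul_coordProj_le _ (norm_coordProj_mul_le _ hNδ))
        ((h2.coordProj K K).pow L).norm_le).trans hL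

/-- The block estimate after any number of steps of cyclic reduction. -/
theorem sigma_block_phi_cr_le {A : BlockTriple m} (hA : A.IsNonneg) {t δ : ℝ} (ht : 1 < t)
    (hbd : A.IsBoundedOn t δ) {k : ℕ} {K : Finset (Fin m)}
    (hm : (block A.Am Kᶜ K).rank ≤ k) (h0 : (block A.A0 Kᶜ K).rank ≤ k)
    (hp : (block A.Ap Kᶜ K).rank ≤ k) (h : ℕ) {z : ℂ} (hz : ‖z‖ = 1) {I J : Finset (Fin m)}
    (hI : I ⊆ Kᶜ) (hJ : J ⊆ K) (s : ℕ) :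
    sigma s (block ((A.cr h).phi z) I J) ≤ 1 + δ ∧
    ∀ n : ℕ, 3 * k * (2 * n + 1) ≤ s - 1 → sigma s (block ((A.cr h).phi z) I J) ≤
      (1 + δ) * (2 * δ ^ 3 * t⁻¹ ^ (n + 1) / (1 - t⁻¹)) *
        ((1 + δ) + (1 + δ) * δ * (1 + δ)) := by
  have hti : t⁻¹ < 1 := inv_lt_one_of_one_lt₀ ht
  obtain ⟨hs1, hδ1⟩ := hbd 1 hti.le ht.le
  obtain ⟨hA', hs', hhull⟩ := hA.cr hs1 h
  set A' := A.cr h with hA'def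
  have hhullδ : convexHull ℝ A.circleInverses ⊆ Metric.closedBall 0 δ := by
    refine convexHull_min ?_ (convex_closedBall 0 δ)
    rintro _ ⟨w, hw, rfl⟩
    exact mem_closedBall_zero_iff.2 (norm_inv_phi_le hA hs1 hδ1 (by simpa using hw))
  have hδ' : ‖(1 - A'.symbol 1)⁻¹‖ ≤ δ := by
    have h1 := mem_closedBall_zero_iff.1 (hhullδ (hhull 1 (by simp)))
    have h2 : A'.phi 1 = (1 - A'.symbol 1).map Complex.ofReal := by
      simpa using A'.phi_ofReal 1
    have hu := isUnit_one_sub_of_isSubcritical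
      (isDominatedBy_self (hA'.symbol_nonneg zero_le_one)) hs'
    rw [h2, map_ofReal_inv hu] at h1
    exact (norm_le_norm_map_ofReal _).trans h1
  have hone : ‖(1 : Matrix (Fin m) (Fin m) ℂ)‖ ≤ 1 := by
    simpa [coordProj] using norm_coordProj_le (Finset.univ : Finset (Fin m))
  have hM : ‖A'.phi z‖ ≤ 1 + δ := by
    rw [phi_eq_one_sub]
    exact (norm_sub_le _ _).trans (add_le_add hone (norm_csymbol_le hA' hs' hδ' hz))
  have hu := hA'.isUnit_phi hs' hz
  rw [Matrix.isUnit_iff_isUnit_det] at hu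
  have hMN := Matrix.mul_nonsing_inv _ hu
  have hNM := Matrix.nonsing_inv_mul _ hu
  refine ⟨?_, fun n hn => ?_⟩
  · refine (sigma_block_le hI hJ _ 0 (by simp)).trans ?_
    rw [sub_zero]
    exact norm_mul_coordProj_le _ (norm_coordProj_mul_le _ hM)
  set P := coordProj K with hPdef
  set Q := coordProj Kᶜ with hQdef
  have hdom : IsDominatedBy (Q * (1 - A'.phi z) * Q) (A'.symbol 1) := by
    have h1 := hA'.isDominatedBy z
    rw [hz] at h1
    rw [phi_eq_one_sub, sub_sub_cancel]
    exact h1.coordProj _ _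
  have hD := one_sub_mul_inv (isUnit_one_sub_of_isSubcritical hdom hs')
  have hDδ : ‖(1 - Q * (1 - A'.phi z) * Q)⁻¹‖ ≤ δ :=
    (hdom.inv_one_sub hs').norm_le.trans hδ'
  have key := offDiagonal_eq_mul_offDiagonal_inv (coordProj_mul_self K) (coordProj_compl K)
    hMN hNM hD
  set M := A'.phi z with hMdef
  set D := (1 - Q * (1 - M) * Q)⁻¹ with hDdef
  have hW : ‖P * M * P - P * M * Q * D * Q * M * P‖ ≤ (1 + δ) + (1 + δ) * δ * (1 + δ) := by
    refine (norm_sub_le _ _).trans (add_le_add ?_ ?_)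
    · exact norm_mul_coordProj_le _ (norm_coordProj_mul_le _ hM)
    · rw [mul_assoc (P * M * Q * D) Q M, mul_assoc (P * M * Q * D) (Q * M) P]
      exact norm_mul_le_of_le (norm_mul_le_of_le
        (norm_mul_coordProj_le _ (norm_coordProj_mul_le _ hM)) hDδ)
        (norm_mul_coordProj_le _ (norm_coordProj_mul_le _ hM))
  set W := P * M * P - P * M * Q * D * Q * M * P with hWdef
  have hQMQ : ‖-(Q * M * Q)‖ ≤ 1 + δ := by
    rw [norm_neg]
    exact norm_mul_coordProj_le _ (norm_coordProj_mul_le _ hM)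
  set b := 2 * δ ^ 3 * t⁻¹ ^ (n + 1) / (1 - t⁻¹) with hb
  have hε : ∀ ε > 0, sigma s (block M I J) ≤
      (1 + δ) * (b + ε) * ((1 + δ) + (1 + δ) * δ * (1 + δ)) := fun ε hε => by
    obtain ⟨Λ, hΛ, hNΛ⟩ := exists_rank_le_norm_sub_le hA ht hbd hm h0 hp n hε (hhull z hz)
    refine (sigma_block_le hI hJ M (-(Q * M * Q) * Λ * W) ?_).trans ?_
    · exact ((Matrix.rank_mul_le_left _ _).trans (Matrix.rank_mul_le_right _ _)).trans
        (hΛ.trans hn)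
    · rw [key, ← sub_mul, ← mul_sub]
      exact norm_mul_le_of_le (norm_mul_le_of_le hQMQ hNΛ) hW
  have hlim : Filter.Tendsto (fun ε : ℝ => (1 + δ) * (b + ε) * ((1 + δ) + (1 + δ) * δ * (1 + δ)))
      (nhdsWithin 0 (Set.Ioi 0)) (nhds ((1 + δ) * (b + 0) * ((1 + δ) + (1 + δ) * δ * (1 + δ)))) := by
    refine tendsto_nhdsWithin_of_tendsto_nhds (Continuous.tendsto ?_ 0)
    fun_prop
  rw [add_zero] at hlim
  exact ge_of_tendsto hlim (eventually_mem_nhdsWithin.mono hε)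

/-- Membership in `χ_{δ,t}` makes the symbol of the centred triple subcritical on the whole
annulus. -/
theorem isBoundedOn_rescale_theta {A : BlockTriple m} {t δ : ℝ} (ht : 1 < t) {k : ℕ}
    (hA : MemChi δ t k A) : (A.rescale A.theta).IsBoundedOn t δ := by
  have ht0 : 0 < t := one_pos.trans ht
  have hti : t⁻¹ < 1 := inv_lt_one_of_one_lt₀ ht
  have hθ : 0 < A.theta :=
    hA.eigMod_pos.trans (eigMod_lt_theta ht hA.eigMod_pos hA.lt_ratio).1
  have hn := hA.isQBD.isNonneg.rescale hθ.le
  have hphi : ∀ x : ℝ, A.phi (A.theta * x) =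
      (1 - (A.rescale A.theta).symbol x).map Complex.ofReal := fun x => by
    rw [← phi_rescale, phi_ofReal]
  have hnorm : ∀ x : ℝ, t⁻¹ ≤ x → ‖(x : ℂ)‖ = x := fun x hx => by
    rw [Complex.norm_real, Real.norm_of_nonneg ((inv_pos.2 ht0).le.trans hx)]
  have hunit : ∀ x : ℝ, t⁻¹ ≤ x → x ≤ t → IsUnit (1 - (A.rescale A.theta).symbol x) :=
    fun x hx hx' => by
      rw [← isUnit_map_ofReal_iff, ← hphi]
      exact hA.isUnit_phi x (by rwa [hnorm x hx]) (by rwa [hnorm x hx])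
  have h1 : IsSubcritical ((A.rescale A.theta).symbol 1) := by
    rw [symbol_rescale, mul_one]
    exact isSubcritical_symbol_theta hA.isQBD ht hA.eigMod_pos hA.lt_ratio fun z hz =>
      hA.isUnit_phi z (by rw [hz]; exact hti.le) (by rw [hz]; exact ht.le)
  intro x hx hx'
  refine ⟨isSubcritical_of_path (isPreconnected_Icc (a := t⁻¹) (b := t))
    ((A.rescale A.theta).continuousOn_symbol.mono fun y hy => (inv_pos.2 ht0).trans_le hy.1)
    (fun y hy => hn.symbol_nonneg ((inv_pos.2 ht0).le.trans hy.1))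
    (fun y hy => hunit y hy.1 hy.2) ⟨hti.le, ht.le⟩ ⟨hx, hx'⟩ h1, ?_⟩
  have h2 := hA.norm_inv_le x (by rwa [hnorm x hx]) (by rwa [hnorm x hx])
  rw [hphi, map_ofReal_inv (hunit x hx hx')] at h2
  exact (norm_le_norm_map_ofReal _).trans h2

end BlockTriple

/-- An off-diagonal submatrix lies in an off-diagonal block with complementary index sets. -/
theorem IsOffDiagonal.exists_compl {m : ℕ} {I J : Finset (Fin m)} (h : IsOffDiagonal I J) :
    ∃ K : Finset (Fin m), I ⊆ Kᶜ ∧ J ⊆ K ∧ IsOffDiagonal Kᶜ K := by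
  classical
  rcases h with h | h
  · refine ⟨Finset.univ.filter fun j => ∀ i ∈ I, j < i, fun i hi => ?_, fun j hj => ?_, ?_⟩
    · simpa using ⟨i, hi, le_rfl⟩
    · simpa using fun i hi => h i hi j hj
    · refine Or.inl fun q hq p hp => ?_
      simp only [Finset.mem_compl, Finset.mem_filter, Finset.mem_univ, true_and, not_forall,
        not_lt] at hq hp
      obtain ⟨i, hi, hiq⟩ := hq
      exact (hp i hi).trans_le hiq
  · refine ⟨Finset.univ.filter fun j => ∀ i ∈ I, i < j, fun i hi => ?_, fun j hj => ?_, ?_⟩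
    · simpa using ⟨i, hi, le_rfl⟩
    · simpa using fun i hi => h i hi j hj
    · refine Or.inr fun q hq p hp => ?_
      simp only [Finset.mem_compl, Finset.mem_filter, Finset.mem_univ, true_and, not_forall,
        not_lt] at hq hp
      obtain ⟨i, hi, hiq⟩ := hq
      exact hiq.trans_lt (hp i hi)

theorem IsQuasiseparable.smul {m k : ℕ} {M : Matrix (Fin m) (Fin m) ℝ}
    (h : IsQuasiseparable k M) (a : ℝ) : IsQuasiseparable k (a • M) := fun I J hIJ => by
  have e : block (a • M) I J = (a • (1 : Matrix I I ℝ)) * block M I J := by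
    rw [Matrix.smul_mul, Matrix.one_mul]
    rfl
  rw [e]
  exact (Matrix.rank_mul_le_right _ _).trans (h I J hIJ)

/-! ### The decay of the singular values -/

theorem mainTheorem3 (t δ : ℝ) (ht : 1 < t) (hδ : 0 ≤ δ) :
    ∃ γ : ℝ, ∀ (k m : ℕ) (A : BlockTriple m), 1 ≤ k → MemChi δ t k A →
      ∀ h : ℕ, IsUnit (((A.rescale A.theta).cr h).A0 - 1) ∧
        ∀ z : ℂ, ‖z‖ = 1 → ∀ I J : Finset (Fin m), IsOffDiagonal I J → ∀ s : ℕ, 1 ≤ s →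
          sigma s (block (((A.rescale A.theta).cr h).phi z) I J) ≤
            γ * Real.exp (-(((s : ℝ) - 3 * k) / (6 * k)) * Real.log t) := by
  have ht0 : 0 < t := one_pos.trans ht
  have hti : t⁻¹ < 1 := inv_lt_one_of_one_lt₀ ht
  have hlog : 0 < Real.log t := Real.log_pos ht
  have h1t : 0 < 1 - t⁻¹ := sub_pos.2 hti
  -- the first summand serves for `s ≤ 3 k`, the second one for `s > 3 k`
  set c := (1 + δ) * (2 * δ ^ 3 / (1 - t⁻¹)) * ((1 + δ) + (1 + δ) * δ * (1 + δ)) with hc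
  have hc0 : 0 ≤ c := by positivity
  refine ⟨(1 + δ) + c, fun k m A hk hA h => ?_⟩
  have hbd := BlockTriple.isBoundedOn_rescale_theta ht hA
  have hn : (A.rescale A.theta).IsNonneg := hA.isQBD.isNonneg.rescale (Real.sqrt_nonneg _)
  obtain ⟨hn', hs', -⟩ := hn.cr (hbd 1 hti.le ht.le).1 h
  refine ⟨?_, fun z hz I J hIJ s hs => ?_⟩
  · rw [← neg_sub]
    exact (hn'.isUnit_one_sub_A0 hs').neg
  obtain ⟨K, hI, hJ, hK⟩ := hIJ.exists_compl
  obtain ⟨hb1, hb2⟩ := BlockTriple.sigma_block_phi_cr_le hn ht hbd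
    (hA.quasisep_m.smul _ _ _ hK) (hA.quasisep_0 _ _ hK) (hA.quasisep_p.smul _ _ _ hK)
    h hz hI hJ s
  have hk0 : (0 : ℝ) < 6 * k := by
    have : (0 : ℝ) < k := by exact_mod_cast hk
    linarith
  set e := Real.exp (-(((s : ℝ) - 3 * k) / (6 * k)) * Real.log t) with he
  have he0 : 0 < e := Real.exp_pos _
  rcases le_or_gt s (3 * k) with hsk | hsk
  · have he1 : 1 ≤ e := by
      rw [he, Real.one_le_exp_iff]
      refine mul_nonneg ?_ hlog.le
      rw [neg_nonneg]
      refine div_nonpos_of_nonpos_of_nonneg ?_ hk0.le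
      have : (s : ℝ) ≤ 3 * k := by exact_mod_cast hsk
      linarith
    nlinarith
  · -- the largest `n` whose approximations have rank at most `s - 1`
    obtain ⟨n, hn1, hn2⟩ : ∃ n : ℕ, 3 * k * (2 * n + 1) ≤ s - 1 ∧ s ≤ 3 * k * (2 * n + 3) := by
      have h3k : 0 < 3 * k := by omega
      have ha : 1 ≤ (s - 1) / (3 * k) := (Nat.one_le_div_iff h3k).2 (by omega)
      have hlt := Nat.lt_mul_div_succ (s - 1) h3k
      have hle := Nat.mul_div_le (s - 1) (3 * k)
      generalize (s - 1) / (3 * k) = a at ha hlt hle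
      refine ⟨(a - 1) / 2, (Nat.mul_le_mul_left _ (by omega)).trans hle, ?_⟩
      have := Nat.mul_le_mul_left (3 * k) (show a + 1 ≤ 2 * ((a - 1) / 2) + 3 by omega)
      omega
    have hpow : t⁻¹ ^ (n + 1) ≤ e := by
      have hexp : t⁻¹ ^ (n + 1) = Real.exp (-((n + 1 : ℕ) : ℝ) * Real.log t) := by
        rw [neg_mul, Real.exp_neg, Real.exp_nat_mul, Real.exp_log ht0, inv_pow]
      rw [hexp, he]
      refine Real.exp_le_exp.2 (mul_le_mul_of_nonneg_right (neg_le_neg ?_) hlog.le)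
      rw [div_le_iff₀ hk0]
      have : (s : ℝ) ≤ 3 * k * (2 * n + 3) := by exact_mod_cast hn2
      push_cast
      linarith
    calc _ ≤ _ := hb2 n hn1
      _ = c * t⁻¹ ^ (n + 1) := by rw [hc]; ring
      _ ≤ c * e := mul_le_mul_of_nonneg_left hpow hc0
      _ ≤ _ := mul_le_mul_of_nonneg_right (by linarith) he0.le
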